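/- **Setting.** Let $\mathbb{F}$ be a field of characteristic $\neq 2$. For a vector space $V$ over $\mathbb{F}_2$ with a bilinear form $g$, put $Q(v)=g(v,v)$ and $f(v,w)=g(v,w)+g(w,v)$. Let $\mathfrak{C}(V,g)$ be the associative $\mathbb{F}$-algebra with basis $\{e_v\mid v\in V\}$ and product $e_ve_w=(-1)^{g(v,w)}e_{v+w}$, regarded as a Lie algebra with bracket $[x,y]=\frac12(xy-yx)$. The *cotriangular space* $\Pi(V,Q)$ has as points the vectors $v$ with $Q(v)=1$ and $v\notin\mathrm{Rad}(f)$, and as lines the triples $\{v,w,v+w\}$ with $v\ne w$ and $Q(v)=Q(w)=f(v,w)=1$. In any point-line space, two points $p,q$ are *equivalent* if the set of points collinear with and different from $p$ equals the set of points collinear with and different from $q$; the *reduction* of the space has the equivalence classes as points and the images of the lines as lines. A *subspace* is a set of points that contains every line meeting it in two points. For a graph $\Gamma$ (finite or infinite) with vertex set $\mathcal V$, all of whose vertices are black, let $V_\Gamma$ be the $\mathbb{F}_2$-space of finite subsets of $\mathcal V$ (with symmetric difference as addition), fix a total order on $\mathcal V$, and let $g_\Gamma(u,w)$ be the number modulo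 $2$ of pairs $(x,y)\in u\times w$ such that $x=y$, or $x<y$ and $x,y$ are adjacent; let $Q_\Gamma,f_\Gamma$ be the corresponding forms and $\mathfrak{C}(\Gamma)=\mathfrak{C}(V_\Gamma,g_\Gamma)$. Let $\mathfrak{K}(\Gamma)$ be the Lie subalgebra of (the Lie algebra of) $\mathfrak{C}(\Gamma)$ generated by the elements $e_{\{x\}}$, $x\in\mathcal V$, and let $\mathfrak{g}(\Gamma)$ be the Lie subalgebra of $\mathfrak{C}(\Gamma)$ spanned linearly by the $e_v$ with $v$ a point of $\Pi(V_\Gamma,Q_\Gamma)$. (It is the span $\mathfrak{g}(V_\Gamma,Q_\Gamma)$ of all $e_v$ with $Q_\Gamma(v)=1$ whenever $Q_\Gamma$ vanishes on $\mathrm{Rad}(f_\Gamma)$.) The *reduced graph* $\overline\Gamma$ has as vertices the classes of vertices of $\Gamma$, where two vertices are equivalent if the same points of $\Pi(V_\Gamma,Q_\Gamma)$ are collinear with and different from them; two distinct classes are adjacent if they contain adjacent vertices. Let $\Pi(\overline\Gamma)$ be the subspace of the reduction of $\Pi(V_\Gamma,Q_\Gamma)$ generated by the classes of the vertices of $\Gamma$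 (which are points of it as soon as $\Gamma$ has at least two vertices), with the lines contained in it. For a set $\Omega$, let $\mathcal{T}(\Omega)$ have the $2$-subsets of $\Omega$ as points and, for every $3$-subset $T$ of $\Omega$, the set of $2$-subsets of $T$ as a line. Let $g$ be a bilinear form on $\mathbb{F}_2\Omega$ whose quadratic form satisfies $Q(\omega)=0$ and $Q(\omega+\omega')=1$ for all distinct $\omega,\omega'\in\Omega$ (for a total order on $\Omega$, take $g(\omega,\omega')=1$ if $\omega<\omega'$ and $0$ otherwise), and let $\mathfrak{g}(\Omega)$ be the Lie subalgebra of $\mathfrak{C}(\mathbb{F}_2\Omega,g)$ spanned linearly by the $e_v$ with $v$ of weight two. **Theorem.** Let $\Gamma$ be a connected graph all of whose vertices are black. 1. If $\overline\Gamma$ is not a line graph, then $\mathfrak{K}(\Gamma)$ has a quotient isomorphic to $\mathfrak{g}(\overline\Gamma)$. In particular, if moreover $Q_{\overline\Gamma}$ vanishes on $\mathrm{Rad}(f_{\overline\Gamma})$, then $\mathfrak{K}(\Gamma)$ has a quotient isomorphic to $\mathfrak{g}(V_{\overline\Gamma},Q_{\overline\Gamma})$. 2. If $\overline\Gamma$ is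 a line graph, then there is a set $\Omega$ such that $\Pi(\overline\Gamma)\cong\mathcal{T}(\Omega)$ and $\mathfrak{K}(\Gamma)$ has a quotient isomorphic to $\mathfrak{g}(\Omega)$; if $|\Omega|=n$ is finite, then $\mathfrak{g}(\Omega)\cong\mathfrak{so}(n,\mathbb{F})$. -/

import Mathlib

universe u w

noncomputable section

namespace QuasiClifford

/-! ## The twisted group algebra of a bilinear form over the field with two elements -/

section Algebra

variable (F : Type w) [Field F] {V : Type u} [AddCommGroup V] [Module (ZMod 2) V]

/-- The sign `(-1) ^ a` of `a : ZMod 2`. -/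
def sgn (a : ZMod 2) : F := (-1) ^ a.val

theorem sgn_zero : sgn F 0 = 1 := by simp [sgn]

theorem sgn_one : sgn F 1 = -1 := by simp [sgn, ZMod.val_one]

theorem zmod2_cases (a : ZMod 2) : a = 0 ∨ a = 1 := by
  revert a; decide

theorem sgn_add (a b : ZMod 2) : sgn F (a + b) = sgn F a * sgn F b := by
  rcases zmod2_cases a with rfl | rfl <;> rcases zmod2_cases b with rfl | rfl <;>
    simp [sgn_zero, sgn_one, show (1 : ZMod 2) + 1 = 0 from rfl]

/-- The algebra `𝔆(V, g)` over `F`: as a vector space it has the basis `e_v`, `v ∈ V`. -/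
def Cliff (_g : LinearMap.BilinForm (ZMod 2) V) : Type (max u w) := V →₀ F

variable {F} (g : LinearMap.BilinForm (ZMod 2) V)

instance : AddCommGroup (Cliff F g) := inferInstanceAs (AddCommGroup (V →₀ F))

instance : Module F (Cliff F g) := inferInstanceAs (Module F (V →₀ F))

variable (F)

/-- The basis vector `e_v` of `𝔆(V, g)`. -/
def e (v : V) : Cliff F g := (Finsupp.single v 1 : V →₀ F)

variable {F}

/-- Linear maps out of `𝔆(V, g)` agree if they agree on the basis vectors. -/
theorem hom_ext {M : Type*} [AddCommGroup M] [Module F M] {φ ψ : Cliff F g →ₗ[F] M}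
    (h : ∀ v, φ (e F g v) = ψ (e F g v)) : φ = ψ :=
  Finsupp.lhom_ext' (M := F) (fun v => LinearMap.ext_ring (h v))

variable (F) in
/-- The product of `𝔆(V, g)`, the bilinear map with `e_v e_w = (-1) ^ g(v, w) e_{v + w}`. -/
def mulMap : Cliff F g →ₗ[F] Cliff F g →ₗ[F] Cliff F g :=
  Finsupp.linearCombination F (fun v : V =>
    (Finsupp.linearCombination F (fun w : V => sgn F (g v w) • e F g (v + w)) :
      (V →₀ F) →ₗ[F] Cliff F g))

theorem mulMap_e (v w : V) :
    mulMap F g (e F g v) (e F g w) = sgn F (g v w) • e F g (v + w) := by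
  have h1 : mulMap F g (e F g v) = (Finsupp.linearCombination F
      (fun w : V => sgn F (g v w) • e F g (v + w)) : (V →₀ F) →ₗ[F] Cliff F g) := by
    refine (Finsupp.linearCombination_single F (1 : F) v).trans (one_smul F _)
  rw [h1]
  exact (Finsupp.linearCombination_single F (1 : F) w).trans (one_smul F _)

theorem mulMap_assoc (x y z : Cliff F g) :
    mulMap F g (mulMap F g x y) z = mulMap F g x (mulMap F g y z) := by
  have key : (mulMap F g).compr₂ (mulMap F g) =
      ((LinearMap.llcomp F (Cliff F g) (Cliff F g) (Cliff F g)).flip.comp (mulMap F g)).flip.comp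
        (mulMap F g) := by
    refine hom_ext g fun u => hom_ext g fun v => hom_ext g fun t => ?_
    simp only [LinearMap.compr₂_apply, LinearMap.comp_apply, LinearMap.flip_apply,
      LinearMap.llcomp_apply, mulMap_e, map_smul, LinearMap.smul_apply, smul_smul, map_add,
      LinearMap.add_apply, sgn_add, add_assoc]
    congr 1
    ring
  exact LinearMap.congr_fun (LinearMap.congr_fun (LinearMap.congr_fun key x) y) z

theorem one_mulMap (x : Cliff F g) : mulMap F g (e F g 0) x = x := by
  have key : mulMap F g (e F g 0) = LinearMap.id :=
    hom_ext g fun v => by simp [mulMap_e, sgn_zero]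
  rw [key]; rfl

theorem mulMap_one (x : Cliff F g) : mulMap F g x (e F g 0) = x := by
  have key : (mulMap F g).flip (e F g 0) = LinearMap.id :=
    hom_ext g fun v => by simp [mulMap_e, sgn_zero]
  exact LinearMap.congr_fun key x

instance : Ring (Cliff F g) :=
  { (inferInstance : AddCommGroup (Cliff F g)) with
    mul := fun x y => mulMap F g x y
    one := e F g 0
    mul_assoc := mulMap_assoc g
    one_mul := one_mulMap g
    mul_one := mulMap_one g
    left_distrib := fun x y z => map_add (mulMap F g x) y z
    right_distrib := fun x y z => LinearMap.map_add₂ (mulMap F g) x y z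
    zero_mul := fun x => LinearMap.map_zero₂ (mulMap F g) x
    mul_zero := fun x => map_zero (mulMap F g x) }

instance : Algebra F (Cliff F g) :=
  Algebra.ofModule (fun r x y => LinearMap.map_smul₂ (mulMap F g) r x y)
    (fun r x y => map_smul (mulMap F g x) r y)

theorem e_mul_e (v w : V) : e F g v * e F g w = sgn F (g v w) • e F g (v + w) :=
  mulMap_e g v w

end Algebra

/-! ## The Lie algebra of an associative algebra, with bracket `[x, y] = (x y - y x) / 2` -/

section HalfLie

variable (F : Type*) [Field F] (A : Type*) [Ring A] [Algebra F A]

/-- The Lie algebra of an associative `F`-algebra `A`; as a vector space this is `A`. -/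
def HalfLie (_F A : Type*) : Type _ := A

instance : AddCommGroup (HalfLie F A) := inferInstanceAs (AddCommGroup A)

instance : Module F (HalfLie F A) := inferInstanceAs (Module F A)

variable {A} in
/-- An element of `A`, seen in the Lie algebra of `A`. -/
def toHalfLie (a : A) : HalfLie F A := a

variable {A} in
/-- The bracket `(x y - y x) / 2`. -/
def halfBracket (x y : A) : A := (2 : F)⁻¹ • (x * y - y * x)

variable {A} in
theorem halfBracket_add_left (x y z : A) :
    halfBracket F (x + y) z = halfBracket F x z + halfBracket F y z := by
  rw [halfBracket, halfBracket, halfBracket, ← smul_add]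
  congr 1
  noncomm_ring

variable {A} in
theorem halfBracket_add_right (x y z : A) :
    halfBracket F x (y + z) = halfBracket F x y + halfBracket F x z := by
  rw [halfBracket, halfBracket, halfBracket, ← smul_add]
  congr 1
  noncomm_ring

variable {A} in
theorem halfBracket_leibniz (x y z : A) : halfBracket F x (halfBracket F y z) =
    halfBracket F (halfBracket F x y) z + halfBracket F y (halfBracket F x z) := by
  simp only [halfBracket, mul_smul_comm, smul_mul_assoc, ← smul_sub, ← smul_add]
  congr 2
  noncomm_ring

variable {A} in
theorem halfBracket_smul (r : F) (x y : A) :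
    halfBracket F x (r • y) = r • halfBracket F x y := by
  rw [halfBracket, halfBracket, mul_smul_comm, smul_mul_assoc, ← smul_sub, smul_comm]

instance : LieRing (HalfLie F A) where
  bracket x y := halfBracket (A := A) F x y
  add_lie x y z := halfBracket_add_left (A := A) F x y z
  lie_add x y z := halfBracket_add_right (A := A) F x y z
  lie_self x := by
    change halfBracket (A := A) F x x = (0 : A)
    simp [halfBracket]
  leibniz_lie x y z := halfBracket_leibniz (A := A) F x y z

instance : LieAlgebra F (HalfLie F A) where
  lie_smul r x y := halfBracket_smul (A := A) F r x y

end HalfLie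

/-! ## The Lie algebras `𝔤(V, g)`, `𝔤(V, Q)` and the span of the points of `Π(V, Q)` -/

section LieOfForm

variable (F : Type w) [Field F] {V : Type u} [AddCommGroup V] [Module (ZMod 2) V]
  (g : LinearMap.BilinForm (ZMod 2) V)

/-- The quadratic form `Q(v) = g(v, v)`; its polar form is `f(v, w) = g(v, w) + g(w, v)`. -/
abbrev quad : QuadraticForm (ZMod 2) V := g.toQuadraticMap

theorem polar_quad (v w : V) : QuadraticMap.polar (quad g) v w = g v w + g w v :=
  LinearMap.BilinMap.polar_toQuadraticMap (B := g) v w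

/-- The Lie algebra of the associative algebra `𝔆(V, g)`. -/
abbrev LieCliff : Type _ := HalfLie F (Cliff F g)

/-- The basis vector `e_v`, seen in the Lie algebra of `𝔆(V, g)`. -/
def lieE (v : V) : LieCliff F g := toHalfLie F (e F g v)

theorem lie_lieE (v w : V) : ⁅lieE F g v, lieE F g w⁆ =
    ((2 : F)⁻¹ * (sgn F (g v w) - sgn F (g w v))) • lieE F g (v + w) := by
  change halfBracket (A := Cliff F g) F (e F g v) (e F g w) = _ • e F g (v + w)
  rw [halfBracket, e_mul_e, e_mul_e, add_comm w v, ← sub_smul, smul_smul]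
  rfl

/-- The linear span of the `e_v`, `v ∈ S`, as a Lie subalgebra, for a set `S` of vectors which
contains the sum of any two of its elements that are not orthogonal. -/
def spanLie (S : Set V)
    (hS : ∀ v ∈ S, ∀ w ∈ S, QuadraticMap.polar (quad g) v w = 1 → v + w ∈ S) :
    LieSubalgebra F (LieCliff F g) :=
  { Submodule.span F (lieE F g '' S) with
    lie_mem' := by
      intro x y hx hy
      change x ∈ Submodule.span F (lieE F g '' S) at hx
      change y ∈ Submodule.span F (lieE F g '' S) at hy
      change ⁅x, y⁆ ∈ Submodule.span F (lieE F g '' S)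
      induction hx, hy using Submodule.span_induction₂ with
      | mem_mem x y hx hy =>
        obtain ⟨v, hv, rfl⟩ := hx
        obtain ⟨w, hw, rfl⟩ := hy
        rw [lie_lieE]
        rcases zmod2_cases (QuadraticMap.polar (quad g) v w) with h | h
        · rw [polar_quad] at h
          have h2 : g v w = g w v := by
            rcases zmod2_cases (g v w) with a | a <;> rcases zmod2_cases (g w v) with b | b <;>
              simp_all
          simp [h2]
        · exact Submodule.smul_mem _ _ (Submodule.subset_span ⟨_, hS v hv w hw h, rfl⟩)
      | zero_left y hy => simp
      | zero_right x hx => simp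
      | add_left x y z _ _ _ h1 h2 => rw [add_lie]; exact Submodule.add_mem _ h1 h2
      | add_right x y z _ _ _ h1 h2 => rw [lie_add]; exact Submodule.add_mem _ h1 h2
      | smul_left r x y _ _ h => rw [smul_lie]; exact Submodule.smul_mem _ _ h
      | smul_right r x y _ _ h => rw [lie_smul]; exact Submodule.smul_mem _ _ h }

/-- A point of the cotriangular space `Π(V, Q)`: a vector `v` with `Q(v) = 1` that does not lie in
the radical of the polar form `f`. -/
def IsPoint (Q : QuadraticForm (ZMod 2) V) (v : V) : Prop :=
  Q v = 1 ∧ ∃ w, QuadraticMap.polar Q v w ≠ 0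

theorem quad_add {v w : V} (hv : quad g v = 1) (hw : quad g w = 1)
    (h : QuadraticMap.polar (quad g) v w = 1) : quad g (v + w) = 1 := by
  rw [QuadraticMap.map_add (quad g) v w, hv, hw, h]; decide

/-- `𝔤(V, Q)`: the linear span of all `e_v` with `Q(v) = 1`. -/
def nonisotropicLie : LieSubalgebra F (LieCliff F g) :=
  spanLie F g {v | quad g v = 1} fun _ hv _ hw h => quad_add g hv hw h

/-- The linear span of all `e_v`, where `v` is a point of `Π(V, Q)`. -/
def pointLie : LieSubalgebra F (LieCliff F g) :=
  spanLie F g {v | IsPoint (quad g) v} fun v hv w hw h =>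
    ⟨quad_add g hv.1 hw.1 h, v, by
      have h0 : QuadraticMap.polar (quad g) v v = 0 := by
        rw [polar_quad]
        rcases zmod2_cases (g v v) with a | a <;> rw [a] <;> rfl
      rw [QuadraticMap.polar_add_left, h0, zero_add, QuadraticMap.polar_comm, h]
      decide⟩

end LieOfForm

/-! ## Point-line spaces, cotriangular spaces -/

/-- A point-line space with point set `P`: a set of lines, each of which is a set of points. -/
structure PointLine (P : Type*) where
  /-- the lines -/
  lines : Set (Set P)

namespace PointLine

variable {P : Type*} (S : PointLine P)

/-- An isomorphism of point-line spaces: a bijection on points that maps the lines onto the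
lines. -/
structure Iso {P' : Type*} (S : PointLine P) (S' : PointLine P') extends P ≃ P' where
  /-- a set of points is a line if and only if its image is a line -/
  map_lines : ∀ l : Set P, l ∈ S.lines ↔ toEquiv '' l ∈ S'.lines

/-- The set of points collinear with, but different from, `p`. -/
def nbrs (p : P) : Set P := {q | q ≠ p ∧ ∃ l ∈ S.lines, p ∈ l ∧ q ∈ l}

/-- Two points are equivalent if the same points are collinear with, but different from, them. -/
def equivPoints : Setoid P := Setoid.ker S.nbrs

/-- The space of equivalence classes of points, with the images of the lines as lines. -/
def reduction : PointLine (Quotient S.equivPoints) :=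
  ⟨{m | ∃ l ∈ S.lines, m = Quotient.mk S.equivPoints '' l}⟩

/-- A set `X` of points is a subspace if each line that meets `X` in two points is contained
in `X`. -/
def IsSubspace (X : Set P) : Prop :=
  ∀ l ∈ S.lines, (∃ p ∈ l, ∃ q ∈ l, p ≠ q ∧ p ∈ X ∧ q ∈ X) → l ⊆ X

/-- The subspace generated by a set of points. -/
def gen (X : Set P) : Set P := ⋂₀ {Y | S.IsSubspace Y ∧ X ⊆ Y}

/-- A set of points as a point-line space, with the lines contained in it. -/
def restrict (X : Set P) : PointLine X := ⟨{l | Subtype.val '' l ∈ S.lines}⟩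

end PointLine

/-- The cotriangular space `Π(V, Q)`; its lines are the elliptic lines `{v, w, v + w}`. -/
def cotri {V : Type*} [AddCommGroup V] [Module (ZMod 2) V] (Q : QuadraticForm (ZMod 2) V) :
    PointLine {v : V // IsPoint Q v} :=
  ⟨{l | ∃ v w : V, v ≠ w ∧ Q v = 1 ∧ Q w = 1 ∧ QuadraticMap.polar Q v w = 1 ∧
    Subtype.val '' l = {v, w, v + w}}⟩

/-- The cotriangular space `𝒯(Ω)`: points are the two-element subsets of `Ω`, lines are the sets
of all points contained in a given three-element subset of `Ω`. -/
def triangular (Ω : Type*) : PointLine {s : Finset Ω // s.card = 2} :=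
  ⟨{l | ∃ t : Finset Ω, t.card = 3 ∧ l = {s | s.1 ⊆ t}}⟩

/-! ## Graphs -/

section Graph

variable {V : Type u} [LinearOrder V] (Γ : SimpleGraph V) (black : Set V)

open Classical in
/-- The bilinear form `g_Γ` of a graph whose vertices are colored black and white. A vector of
`V →₀ ZMod 2` is identified with the finite set of vertices on which it is nonzero; then
`g_Γ(u, w)` is the number, modulo 2, of pairs `(x, y) ∈ u × w` such that `x < y` and `x` is adjacent
to `y`, or `x = y` is black. -/
def graphForm : LinearMap.BilinForm (ZMod 2) (V →₀ ZMod 2) :=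
  Finsupp.linearCombination (ZMod 2) fun x => Finsupp.linearCombination (ZMod 2) fun y =>
    if (x < y ∧ Γ.Adj x y) ∨ (x = y ∧ x ∈ black) then (1 : ZMod 2) else 0

open Classical in
theorem graphForm_single (x y : V) :
    graphForm Γ black (Finsupp.single x 1) (Finsupp.single y 1) =
      if (x < y ∧ Γ.Adj x y) ∨ (x = y ∧ x ∈ black) then (1 : ZMod 2) else 0 := by
  simp [graphForm]

variable (F : Type w) [Field F]

/-- The vertex `x` as an element of the Lie algebra of `𝔆(Γ)`. -/
def vertexLie (x : V) : LieCliff F (graphForm Γ black) :=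
  lieE F (graphForm Γ black) (Finsupp.single x 1)

/-- `𝔎(Γ)`: the Lie subalgebra, generated by the vertices, of the Lie algebra of `𝔆(Γ)`. -/
def vertexGenerated : LieSubalgebra F (LieCliff F (graphForm Γ black)) :=
  LieSubalgebra.lieSpan F _ (Set.range (vertexLie Γ black F))

/-- The quadratic form `Q_Γ` of a graph all of whose vertices are black. -/
abbrev graphQuad : QuadraticForm (ZMod 2) (V →₀ ZMod 2) := quad (graphForm Γ Set.univ)

/-- The points of `Π(V_Γ, Q_Γ)` that are collinear with, but different from, the vertex `x`. -/
def vertexNbrs (x : V) : Set {v // IsPoint (graphQuad Γ) v} :=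
  {p | p.1 ≠ Finsupp.single x 1 ∧
    ∃ l ∈ (cotri (graphQuad Γ)).lines, p ∈ l ∧ Finsupp.single x 1 ∈ Subtype.val '' l}

/-- Two vertices are equivalent if the same points of `Π(V_Γ, Q_Γ)` are collinear with, but
different from, them. -/
def equivVertices : Setoid V := Setoid.ker (vertexNbrs Γ)

/-- The vertices of the reduced graph: equivalence classes of vertices of `Γ`. -/
abbrev ReducedVertex : Type u := Quotient (equivVertices Γ)

/-- The reduced graph: two different classes are adjacent if they contain adjacent vertices. -/
def reducedGraph : SimpleGraph (ReducedVertex Γ) where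
  Adj a b := a ≠ b ∧ ∃ x y : V,
    Quotient.mk (equivVertices Γ) x = a ∧ Quotient.mk (equivVertices Γ) y = b ∧ Γ.Adj x y
  symm := ⟨fun _ _ h => ⟨h.1.symm, by
    obtain ⟨x, y, hx, hy, hxy⟩ := h.2
    exact ⟨y, x, hy, hx, hxy.symm⟩⟩⟩
  loopless := ⟨fun _ h => h.1 rfl⟩

/-- The points of the reduction of `Π(V_Γ, Q_Γ)` that are classes of vertices of `Γ`. -/
def vertexClasses : Set (Quotient (cotri (graphQuad Γ)).equivPoints) :=
  {c | ∃ (x : V) (h : IsPoint (graphQuad Γ) (Finsupp.single x 1)),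
    c = Quotient.mk (cotri (graphQuad Γ)).equivPoints ⟨Finsupp.single x 1, h⟩}

/-- The subspace, generated by the classes of the vertices of `Γ`, of the reduction of
`Π(V_Γ, Q_Γ)`. -/
def reducedSpace : PointLine ((cotri (graphQuad Γ)).reduction.gen (vertexClasses Γ)) :=
  (cotri (graphQuad Γ)).reduction.restrict _

end Graph

/-- A graph is a line graph if it is isomorphic to the line graph of some graph. -/
def IsLineGraph {V : Type u} (Γ : SimpleGraph V) : Prop :=
  ∃ (Ω : Type u) (Δ : SimpleGraph Ω), Nonempty (Γ ≃g Δ.lineGraph)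

/-! ## The Lie algebra `𝔤(Ω)` -/

section Omega

variable (F : Type w) [Field F] (Ω : Type u) [LinearOrder Ω]

/-- A bilinear form on `𝔽₂Ω` whose quadratic form `Q` satisfies `Q(ω) = 0` and `Q(ω + ω') = 1` for
all `ω ≠ ω'` in `Ω`: the form of the complete graph on `Ω` with all vertices white. -/
abbrev omegaForm : LinearMap.BilinForm (ZMod 2) (Ω →₀ ZMod 2) := graphForm (⊤ : SimpleGraph Ω) ∅

/-- The vectors of weight two in `𝔽₂Ω`. -/
def weightTwo : Set (Ω →₀ ZMod 2) :=
  {v | ∃ a b : Ω, a ≠ b ∧ v = Finsupp.single a 1 + Finsupp.single b 1}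

open Classical in
theorem polar_omega (a b : Ω) : QuadraticMap.polar (quad (omegaForm Ω))
    (Finsupp.single a 1) (Finsupp.single b 1) = if a = b then 0 else 1 := by
  rw [polar_quad, graphForm_single, graphForm_single]
  rcases lt_trichotomy a b with h | h | h
  · simp [h, h.ne, h.not_gt, h.ne']
  · simp [h]
  · simp [h, h.ne, h.not_gt, h.ne']

theorem omega_single (a : Ω) : quad (omegaForm Ω) (Finsupp.single a 1) = 0 := by
  change graphForm _ _ _ _ = _
  rw [graphForm_single]; simp

theorem omega_pair {a b : Ω} (h : a ≠ b) :
    quad (omegaForm Ω) (Finsupp.single a 1 + Finsupp.single b 1) = 1 := by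
  rw [QuadraticMap.map_add (quad (omegaForm Ω)), omega_single, omega_single, polar_omega]; simp [h]

theorem weightTwo_add (v : Ω →₀ ZMod 2) (hv : v ∈ weightTwo Ω) (w : Ω →₀ ZMod 2)
    (hw : w ∈ weightTwo Ω) (h : QuadraticMap.polar (quad (omegaForm Ω)) v w = 1) :
    v + w ∈ weightTwo Ω := by
  obtain ⟨a, b, hab, rfl⟩ := hv
  obtain ⟨c, d, hcd, rfl⟩ := hw
  simp only [QuadraticMap.polar_add_left, QuadraticMap.polar_add_right, polar_omega] at h
  have two (x : Ω) : (Finsupp.single x 1 + Finsupp.single x 1 : Ω →₀ ZMod 2) = 0 := by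
    rw [← Finsupp.single_add, show (1 : ZMod 2) + 1 = 0 from rfl, Finsupp.single_zero]
  by_cases hac : a = c
  · subst hac
    by_cases hbd : b = d
    · subst hbd
      simp [hab, hab.symm] at h
    · exact ⟨b, d, hbd, by rw [add_add_add_comm, two, zero_add]⟩
  by_cases had : a = d
  · subst had
    by_cases hbc : b = c
    · subst hbc
      simp [hab, hab.symm] at h
    · exact ⟨b, c, hbc, by
        rw [add_comm (Finsupp.single c 1), add_add_add_comm, two, zero_add]⟩
  by_cases hbc : b = c
  · subst hbc
    exact ⟨a, d, had, by
      rw [add_comm (Finsupp.single a 1), add_add_add_comm, two, zero_add]⟩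
  by_cases hbd : b = d
  · subst hbd
    exact ⟨a, c, hac, by rw [add_add_add_comm, two, add_zero]⟩
  simp [hac, had, hbc, hbd] at h
  exact absurd h (by decide)

/-- `𝔤(Ω)`: the linear span of the vectors of weight two in the Lie algebra of `𝔆(𝔽₂Ω, Q)`. -/
def omegaLie : LieSubalgebra F (LieCliff F (omegaForm Ω)) :=
  spanLie F (omegaForm Ω) (weightTwo Ω) (weightTwo_add Ω)

end Omega

end QuasiClifford

end

/-! Two basis vectors `e_v`, `e_w` commute when `f(v, w) = 0`; otherwise their bracket is `±
e_{v+w}`. Hence the Lie algebra generated by the `e_x`, `x ∈ X`, is spanned by the `e_v` with `v` in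
the closure `Gen Q X` of `X` under sums of non-orthogonal vectors. A linear map that respects the
quadratic forms induces a homomorphism of the twisted group algebras up to signs (`exists_lieHom`).
So `𝔎(Γ)` maps onto the span of the closure of any family of vectors with `Q = 1` whose
non-orthogonality graph is `Γ` (`exists_quotient_equiv_spanLie`), and the theorem becomes the
computation of two closures.

Vertices are equivalent exactly when they are twins, so the reduced graph is connected and without
twins. Suppose that it is not a line graph. If the closure of its vertices contains a basis of a
six-dimensional space of type `E₆`, then it contains all vectors with `Q = 1` of that space. This
property extends to larger subspaces by one vector at a time, because the `E₆` space leaves enough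
room in any intersection of two hyperplanes; Zorn's lemma and connectedness then give all points
(`gen_of_isPoint_of_hasE6`). If there is no `E₆`, take a maximal clique `C` with at least four
elements in the closure. Each vertex then agrees, modulo the radical, with a sum of two elements of
`C ∪ {0}`, and two such pairs are non-orthogonal exactly when they share one element. So the graph
is a line graph (`isLineGraph_of_clique`), a contradiction.

If the reduced graph is a line graph, the vertices of `Γ` become pairs in a set `Ω`, and
connectedness shows that their closure consists of all vectors of weight two. Lifting these vectors
to the closure in `V_Γ` identifies `Π(Γ̄)` with `𝒯(Ω)`, except when `|Ω| = 4`: complementary pairs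
are then equivalent, and a set of three elements takes the place of `Ω`. Finally, the elements `e_ω`
are Clifford generators, and their bivectors satisfy the relations of the elementary skew-symmetric
matrices, which gives `𝔰𝔬(n)`. -/

noncomputable section

namespace QuasiClifford

open QuadraticMap

/-! ## Quadratic forms over the field with two elements -/

section Closure

variable {V : Type*} [AddCommGroup V] [Module (ZMod 2) V] (Q : QuadraticForm (ZMod 2) V)

theorem polar_self_zero (v : V) : polar Q v v = 0 := by
  rw [QuadraticMap.polar_self, two_smul]
  exact ZModModule.add_self (Q v)

theorem add_add_self (v w : V) : v + w + w = v := by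
  rw [add_assoc, ZModModule.add_self, add_zero]

theorem zmod2_ne_zero {a : ZMod 2} : a ≠ 0 ↔ a = 1 := by
  revert a; decide

theorem zmod2_ne_one {a : ZMod 2} : a ≠ 1 ↔ a = 0 := by
  revert a; decide

theorem quadratic_add (v w : V) : Q (v + w) = Q v + Q w + polar Q v w :=
  QuadraticMap.map_add Q v w

/-- The closure of a set of vectors under sums of two vectors that are not orthogonal. -/
inductive Gen (X : Set V) : V → Prop
  | base {v : V} : v ∈ X → Gen X v
  | add {v w : V} : Gen X v → Gen X w → polar Q v w = 1 → Gen X (v + w)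

variable {Q} {X : Set V}

theorem Gen.quad_eq_one (hX : ∀ v ∈ X, Q v = 1) {v : V} (h : Gen Q X v) : Q v = 1 := by
  induction h with
  | base h => exact hX _ h
  | add _ _ h h1 h2 => rw [quadratic_add, h1, h2, h]; decide

/-- Steps of the closure are reversible: `v + w` and `w` are again non-orthogonal, and their sum is
`v`. -/
theorem Gen.of_add {v w : V} (h : Gen Q X (v + w)) (hw : Gen Q X w) (h1 : polar Q v w = 1) :
    Gen Q X v := by
  have h2 := h.add hw (by rw [polar_add_left, polar_self_zero, h1, add_zero])
  rwa [add_add_self] at h2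

theorem polar_of_quad_eq {W : Type*} [AddCommGroup W] [Module (ZMod 2) W]
    {Q' : QuadraticForm (ZMod 2) W} (π : V →ₗ[ZMod 2] W) (hQ : ∀ v, Q' (π v) = Q v) (v w : V) :
    polar Q' (π v) (π w) = polar Q v w := by
  simp only [polar, ← map_add, hQ]

theorem Gen.map {W : Type*} [AddCommGroup W] [Module (ZMod 2) W]
    {Q' : QuadraticForm (ZMod 2) W} (π : V →ₗ[ZMod 2] W) (hQ : ∀ v, Q' (π v) = Q v) {Y : Set W}
    (hX : ∀ v ∈ X, Gen Q' Y (π v)) {v : V} (hv : Gen Q X v) : Gen Q' Y (π v) := by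
  induction hv with
  | base hv => exact hX _ hv
  | add _ _ h h1 h2 =>
    rw [map_add]
    exact h1.add h2 (by rw [polar_of_quad_eq π hQ, h])

theorem Gen.exists_lift {W : Type*} [AddCommGroup W] [Module (ZMod 2) W]
    {Q' : QuadraticForm (ZMod 2) W} (π : V →ₗ[ZMod 2] W) (hQ : ∀ v, Q' (π v) = Q v)
    {w : W} (hw : Gen Q' (π '' X) w) : ∃ v, Gen Q X v ∧ π v = w := by
  induction hw with
  | base hw =>
    obtain ⟨v, hv, rfl⟩ := hw
    exact ⟨v, .base hv, rfl⟩
  | add _ _ h h1 h2 =>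
    obtain ⟨v, hv, rfl⟩ := h1
    obtain ⟨v', hv', rfl⟩ := h2
    rw [polar_of_quad_eq π hQ] at h
    exact ⟨v + v', hv.add hv' h, map_add π v v'⟩

theorem polar_eq_zero_of_mem_span {r v : V} (h : ∀ x ∈ X, polar Q r x = 0)
    (hv : v ∈ Submodule.span (ZMod 2) X) : polar Q r v = 0 := by
  induction hv using Submodule.span_induction with
  | mem x hx => exact h x hx
  | zero => exact polar_zero_right Q r
  | add x y _ _ h1 h2 => rw [polar_add_right, h1, h2, add_zero]
  | smul a x _ h1 => rw [polar_smul_right, h1, smul_zero]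

end Closure

/-! ## Lie subalgebras generated by basis vectors -/

section LieSpan

variable (F : Type w) [Field F] {V : Type u} [AddCommGroup V] [Module (ZMod 2) V]
  (g : LinearMap.BilinForm (ZMod 2) V)

theorem lie_lieE_of_polar_eq_one (hF : (2 : F) ≠ 0) {v w : V} (h : polar (quad g) v w = 1) :
    ⁅lieE F g v, lieE F g w⁆ = sgn F (g v w) • lieE F g (v + w) := by
  rw [lie_lieE]
  congr 1
  rw [polar_quad] at h
  rcases zmod2_cases (g v w) with a | a <;> rcases zmod2_cases (g w v) with b | b <;>
    rw [a, b] at h <;> rw [a, b] <;> simp only [sgn_zero, sgn_one]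
  · exact absurd h (by decide)
  · rw [sub_neg_eq_add, one_add_one_eq_two, inv_mul_cancel₀ hF]
  · rw [← neg_add', one_add_one_eq_two, mul_neg, inv_mul_cancel₀ hF]
  · exact absurd h (by decide)

theorem sgn_mul_self (a : ZMod 2) : sgn F a * sgn F a = 1 := by
  rcases zmod2_cases a with rfl | rfl <;> simp [sgn_zero, sgn_one]

/-- For non-orthogonal `v`, `w` the bracket is `e_{v+w}` up to a sign, which is its own inverse, so
each step of the closure can be carried out in the Lie subalgebra. -/
theorem lieSpan_eq_spanLie (hF : (2 : F) ≠ 0) (X S : Set V)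
    (hS : ∀ v ∈ S, ∀ w ∈ S, polar (quad g) v w = 1 → v + w ∈ S)
    (h : ∀ v, v ∈ S ↔ Gen (quad g) X v) :
    LieSubalgebra.lieSpan F _ (lieE F g '' X) = spanLie F g S hS := by
  apply le_antisymm
  · rw [LieSubalgebra.lieSpan_le]
    rintro _ ⟨v, hv, rfl⟩
    exact Submodule.subset_span ⟨v, (h v).2 (.base hv), rfl⟩
  · change Submodule.span F (lieE F g '' S) ≤
      (LieSubalgebra.lieSpan F _ (lieE F g '' X)).toSubmodule
    rw [Submodule.span_le]
    rintro _ ⟨v, hv, rfl⟩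
    rw [h] at hv
    change lieE F g v ∈ LieSubalgebra.lieSpan F _ (lieE F g '' X)
    induction hv with
    | base hv => exact LieSubalgebra.subset_lieSpan ⟨_, hv, rfl⟩
    | @add v w _ _ hvw h1 h2 =>
      have h3 := LieSubalgebra.lie_mem _ h1 h2
      rw [lie_lieE_of_polar_eq_one F g hF hvw] at h3
      have h4 := LieSubalgebra.smul_mem _ (sgn F (g v w)) h3
      rwa [smul_smul, sgn_mul_self, one_smul] at h4

theorem map_lieSpan {R L L' : Type*} [CommRing R] [LieRing L] [LieAlgebra R L] [LieRing L']
    [LieAlgebra R L'] (f : L →ₗ⁅R⁆ L') (X : Set L) :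
    (LieSubalgebra.lieSpan R L X).map f = LieSubalgebra.lieSpan R L' (f '' X) := by
  apply le_antisymm
  · rw [LieSubalgebra.map_le_iff_le_comap, LieSubalgebra.lieSpan_le]
    intro x hx
    exact LieSubalgebra.subset_lieSpan ⟨x, hx, rfl⟩
  · rw [LieSubalgebra.lieSpan_le]
    rintro _ ⟨x, hx, rfl⟩
    exact ⟨x, LieSubalgebra.subset_lieSpan hx, rfl⟩

theorem exists_quotient_equiv_map {R L L' : Type*} [CommRing R] [LieRing L] [LieAlgebra R L]
    [LieRing L'] [LieAlgebra R L'] (f : L →ₗ⁅R⁆ L') (K : LieSubalgebra R L)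
    (K' : LieSubalgebra R L') (h : K.map f = K') :
    ∃ I : LieIdeal R K, Nonempty ((K ⧸ I) ≃ₗ⁅R⁆ K') := by
  have h1 : (f.comp K.incl).range = K' := by
    rw [← h]
    ext x
    simp [LieSubalgebra.mem_map]
  rw [← h1]
  exact ⟨(f.comp K.incl).ker, ⟨(f.comp K.incl).quotKerEquivRange⟩⟩

end LieSpan

/-! ## Homomorphisms of twisted group algebras induced by maps of graphs -/

section GraphMap

variable {I : Type u} {W : Type*} [AddCommGroup W] [Module (ZMod 2) W]

/-- Linear maps preserve the quadratic form if they do so on a basis, together with the polar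
form. -/
theorem quadratic_linearCombination (Q : QuadraticForm (ZMod 2) (I →₀ ZMod 2))
    (Q' : QuadraticForm (ZMod 2) W) (p : I → W) (h1 : ∀ x, Q' (p x) = Q (Finsupp.single x 1))
    (h2 : ∀ x y, polar Q' (p x) (p y) = polar Q (Finsupp.single x 1) (Finsupp.single y 1))
    (v : I →₀ ZMod 2) : Q' (Finsupp.linearCombination (ZMod 2) p v) = Q v := by
  have key : (polarBilin Q').compl₁₂ (Finsupp.linearCombination (ZMod 2) p)
      (Finsupp.linearCombination (ZMod 2) p) = polarBilin Q := by
    refine Finsupp.lhom_ext' fun x => LinearMap.ext_ring ?_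
    refine Finsupp.lhom_ext' fun y => LinearMap.ext_ring ?_
    simpa using h2 x y
  induction v using Finsupp.induction_linear with
  | zero => simp
  | add v w hv hw =>
    rw [map_add, quadratic_add, quadratic_add, hv, hw]
    congr 1
    exact LinearMap.congr_fun (LinearMap.congr_fun key v) w
  | single x a =>
    rcases zmod2_cases a with rfl | rfl
    · simp
    · simpa using h1 x

variable [LinearOrder I]

/-- An alternating form is the polar form of a quadratic form that vanishes on the basis. -/
theorem exists_quadratic_polar (h : LinearMap.BilinForm (ZMod 2) (I →₀ ZMod 2))
    (h0 : ∀ v, h v v = 0) : ∃ c : QuadraticForm (ZMod 2) (I →₀ ZMod 2),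
      (∀ x, c (Finsupp.single x 1) = 0) ∧ ∀ v w, polar c v w = h v w := by
  classical
  let b : LinearMap.BilinForm (ZMod 2) (I →₀ ZMod 2) :=
    Finsupp.linearCombination (ZMod 2) fun x => Finsupp.linearCombination (ZMod 2) fun y =>
      if x < y then h (Finsupp.single x 1) (Finsupp.single y 1) else 0
  have hb (x y : I) : b (Finsupp.single x 1) (Finsupp.single y 1) =
      if x < y then h (Finsupp.single x 1) (Finsupp.single y 1) else 0 := by simp [b]
  have hsymm (v w : I →₀ ZMod 2) : h v w = h w v := by
    have h1 := h0 (v + w)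
    simp only [map_add, LinearMap.add_apply, h0, zero_add, add_zero] at h1
    grind
  have key : b + b.flip = h := by
    refine Finsupp.lhom_ext' fun x => LinearMap.ext_ring ?_
    refine Finsupp.lhom_ext' fun y => LinearMap.ext_ring ?_
    change b (Finsupp.single x 1) (Finsupp.single y 1) +
      b (Finsupp.single y 1) (Finsupp.single x 1) = h (Finsupp.single x 1) (Finsupp.single y 1)
    rw [hb, hb]
    rcases lt_trichotomy x y with hxy | rfl | hxy
    · simp [hxy, hxy.not_gt]
    · simp [h0]
    · simp [hxy, hxy.not_gt, hsymm (Finsupp.single y 1)]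
  refine ⟨quad b, fun x => ?_, fun v w => ?_⟩
  · change b _ _ = _
    simp [hb]
  · rw [polar_quad, ← key]; rfl

variable (F : Type w) [Field F]

/-- A linear map that preserves the quadratic forms induces a homomorphism of Lie algebras. -/
theorem exists_lieHom (g : LinearMap.BilinForm (ZMod 2) (I →₀ ZMod 2))
    (g' : LinearMap.BilinForm (ZMod 2) W) (π : (I →₀ ZMod 2) →ₗ[ZMod 2] W)
    (hπ : ∀ v, quad g' (π v) = quad g v) : ∃ Φ : LieCliff F g →ₗ⁅F⁆ LieCliff F g',
      ∀ x, Φ (lieE F g (Finsupp.single x 1)) = lieE F g' (π (Finsupp.single x 1)) := by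
  -- The forms `g` and `g'(π ·, π ·)` have the same quadratic form, so their sum is alternating and
  -- is the polar form of some `c`. Then `e_v ↦ (-1)^{c(v)} e_{π v}` is multiplicative, and it
  -- involves no sign on the basis, where `c` vanishes.
  obtain ⟨c, hc, hpol⟩ := exists_quadratic_polar (g + g'.compl₁₂ π π) (fun v => by
    change quad g v + quad g' (π v) = 0
    rw [hπ]; exact ZModModule.add_self _)
  have hcadd (v w : I →₀ ZMod 2) :
      sgn F (g v w) * sgn F (c (v + w)) = sgn F (c v) * sgn F (c w) * sgn F (g' (π v) (π w)) := by
    rw [← sgn_add, ← sgn_add, ← sgn_add, quadratic_add, hpol]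
    congr 1
    change g v w + (c v + c w + (g v w + g' (π v) (π w))) = _
    grind
  let Φ : Cliff F g →ₗ[F] Cliff F g' :=
    (Finsupp.linearCombination F (fun v => sgn F (c v) • e F g' (π v)) :
      ((I →₀ ZMod 2) →₀ F) →ₗ[F] Cliff F g')
  have hΦ (v : I →₀ ZMod 2) : Φ (e F g v) = sgn F (c v) • e F g' (π v) :=
    (Finsupp.linearCombination_single F (1 : F) v).trans (one_smul F _)
  have hmul (x y : Cliff F g) : Φ (x * y) = Φ x * Φ y := by
    have key : (mulMap F g).compr₂ Φ = (mulMap F g').compl₁₂ Φ Φ := by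
      refine hom_ext g fun v => hom_ext g fun w => ?_
      simp only [LinearMap.compr₂_apply, LinearMap.compl₁₂_apply, mulMap_e, map_smul, hΦ,
        LinearMap.smul_apply, smul_smul, map_add, hcadd]
      congr 1
      ring
    exact LinearMap.congr_fun (LinearMap.congr_fun key x) y
  have hbracket (x y : Cliff F g) : Φ (halfBracket F x y) = halfBracket F (Φ x) (Φ y) := by
    simp only [halfBracket, map_smul, map_sub, hmul]
  refine ⟨{ toLinearMap := (Φ : HalfLie F (Cliff F g) →ₗ[F] HalfLie F (Cliff F g'))
            map_lie' := ?_ }, fun x => ?_⟩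
  · intro x y
    exact hbracket x y
  · refine (hΦ _).trans ?_
    rw [hc, sgn_zero, one_smul]
    rfl

variable (Γ : SimpleGraph I)

theorem graphQuad_single (x : I) : graphQuad Γ (Finsupp.single x 1) = 1 := by
  change graphForm _ _ _ _ = _
  simp [graphForm_single]

open Classical in
theorem polar_graphQuad (x y : I) :
    polar (graphQuad Γ) (Finsupp.single x 1) (Finsupp.single y 1) = if Γ.Adj x y then 1 else 0 := by
  rw [polar_quad, graphForm_single, graphForm_single]
  rcases lt_trichotomy x y with h | h | h
  · simp [h, h.ne, h.not_gt, h.ne']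
  · subst h
    simp only [lt_self_iff_false, Set.mem_univ, and_self, or_true, if_true,
      SimpleGraph.irrefl, if_false]
    decide
  · simp [h, h.ne, h.not_gt, h.ne', Γ.adj_comm]

theorem polar_graphQuad_eq_one (x y : I) :
    polar (graphQuad Γ) (Finsupp.single x 1) (Finsupp.single y 1) = 1 ↔ Γ.Adj x y := by
  rw [polar_graphQuad]; split_ifs with h <;> simp [h]

theorem quad_graphMap {Q' : QuadraticForm (ZMod 2) W} {p : I → W} (hp : ∀ x, Q' (p x) = 1)
    (hadj : ∀ x y, Γ.Adj x y ↔ polar Q' (p x) (p y) = 1) (v : I →₀ ZMod 2) :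
    Q' (Finsupp.linearCombination (ZMod 2) p v) = graphQuad Γ v := by
  refine quadratic_linearCombination _ _ p (fun x => by rw [hp, graphQuad_single]) (fun x y => ?_) v
  rw [polar_graphQuad]
  split_ifs with h
  · exact (hadj x y).1 h
  · rw [hadj, ← zmod2_ne_zero, not_not] at h
    exact h

/-- If the vertices of a graph are mapped to vectors with the same quadratic form and the same
polar form, then `𝔎(Γ)` maps onto the span of the closure of the images of the vertices. -/
theorem exists_quotient_equiv_spanLie (hF : (2 : F) ≠ 0)
    (g' : LinearMap.BilinForm (ZMod 2) W) (p : I → W) (hp : ∀ x, quad g' (p x) = 1)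
    (hadj : ∀ x y, Γ.Adj x y ↔ polar (quad g') (p x) (p y) = 1) (S : Set W)
    (hS : ∀ v ∈ S, ∀ w ∈ S, polar (quad g') v w = 1 → v + w ∈ S)
    (h : ∀ v, v ∈ S ↔ Gen (quad g') (Set.range p) v) :
    ∃ J : LieIdeal F (vertexGenerated Γ Set.univ F),
      Nonempty ((vertexGenerated Γ Set.univ F ⧸ J) ≃ₗ⁅F⁆ spanLie F g' S hS) := by
  obtain ⟨Φ, hΦ⟩ := exists_lieHom F (graphForm Γ Set.univ) g'
    (Finsupp.linearCombination (ZMod 2) p) (quad_graphMap Γ hp hadj)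
  refine exists_quotient_equiv_map Φ _ _ ?_
  rw [vertexGenerated, map_lieSpan, ← lieSpan_eq_spanLie F g' hF (Set.range p) S hS h,
    ← Set.range_comp, ← Set.range_comp]
  congr 2
  funext x
  have h1 := hΦ x
  rw [Finsupp.linearCombination_single, one_smul] at h1
  exact h1

end GraphMap

/-! ## Subspaces all of whose points lie in the closure -/

section Extension

variable {V : Type*} [AddCommGroup V] [Module (ZMod 2) V] (Q : QuadraticForm (ZMod 2) V)
  (X : Set V)

/-- The closure of `X` contains all points of the cotriangular space of the subspace `U`. -/
def IsFull (U : Submodule (ZMod 2) V) : Prop :=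
  ∀ v ∈ U, Q v = 1 → (∃ w ∈ U, polar Q v w = 1) → Gen Q X v

/-- On each coset of the intersection of two hyperplanes of `U`, the quadratic form takes the
value one in at least three classes modulo the radical of `U`. -/
def IsRich (U : Submodule (ZMod 2) V) : Prop :=
  ∀ (φ ψ : V →ₗ[ZMod 2] ZMod 2) (a : V), ∃ d : Fin 3 → V,
    (∀ i, d i ∈ U ∧ φ (d i) = 0 ∧ ψ (d i) = 0 ∧ Q (a + d i) = 1) ∧
    ∀ i j, i ≠ j → ∃ w ∈ U, polar Q (d i + d j) w = 1

variable {Q X}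

theorem IsRich.mono {U U' : Submodule (ZMod 2) V} (h : IsRich Q U) (hU : U ≤ U') :
    IsRich Q U' := by
  intro φ ψ a
  obtain ⟨d, h1, h2⟩ := h φ ψ a
  refine ⟨d, fun i => ⟨hU (h1 i).1, (h1 i).2⟩, fun i j hij => ?_⟩
  obtain ⟨w, hw, h3⟩ := h2 i j hij
  exact ⟨w, hU hw, h3⟩

/-- Pigeonhole on the three candidates `a + d i`: as their differences are not orthogonal to `U`, at
most one candidate is orthogonal to `U`, and at most one becomes so after adding `u`. -/
theorem IsRich.exists_point {U : Submodule (ZMod 2) V} (h : IsRich Q U)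
    (φ ψ : V →ₗ[ZMod 2] ZMod 2) {a u : V} (ha : a ∈ U) (h1 : φ a = 1) (h2 : ψ a = 0) :
    ∃ a ∈ U, Q a = 1 ∧ φ a = 1 ∧ ψ a = 0 ∧ (∃ w ∈ U, polar Q a w = 1) ∧
      ∃ w ∈ U, polar Q (a + u) w = 1 := by
  obtain ⟨d, hd, hdd⟩ := h φ ψ a
  by_contra! hcon
  have hor (i : Fin 3) : (∀ w ∈ U, polar Q (a + d i) w ≠ 1) ∨
      ∀ w ∈ U, polar Q (a + d i + u) w ≠ 1 := by
    by_contra! h3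
    obtain ⟨⟨w, hw, h4⟩, w', hw', h5⟩ := h3
    exact hcon (a + d i) (add_mem ha (hd i).1) (hd i).2.2.2 (by simp [h1, (hd i).2.1])
      (by simp [h2, (hd i).2.2.1]) ⟨w, hw, h4⟩ w' hw' h5
  have hA (i j : Fin 3) (hij : i ≠ j) (h3 : ∀ w ∈ U, polar Q (a + d i) w ≠ 1)
      (h4 : ∀ w ∈ U, polar Q (a + d j) w ≠ 1) : False := by
    obtain ⟨w, hw, h5⟩ := hdd i j hij
    have h6 := zmod2_ne_one.1 (h3 w hw)
    have h7 := zmod2_ne_one.1 (h4 w hw)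
    simp only [polar_add_left] at h5 h6 h7
    grind
  have hB (i j : Fin 3) (hij : i ≠ j) (h3 : ∀ w ∈ U, polar Q (a + d i + u) w ≠ 1)
      (h4 : ∀ w ∈ U, polar Q (a + d j + u) w ≠ 1) : False := by
    obtain ⟨w, hw, h5⟩ := hdd i j hij
    have h6 := zmod2_ne_one.1 (h3 w hw)
    have h7 := zmod2_ne_one.1 (h4 w hw)
    simp only [polar_add_left] at h5 h6 h7
    grind
  rcases hor 0 with h0 | h0 <;> rcases hor 1 with h1 | h1 <;> rcases hor 2 with h2 | h2 <;>
    first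
      | exact hA 0 1 (by decide) h0 h1
      | exact hA 0 2 (by decide) h0 h2
      | exact hA 1 2 (by decide) h1 h2
      | exact hB 0 1 (by decide) h0 h1
      | exact hB 0 2 (by decide) h0 h2
      | exact hB 1 2 (by decide) h1 h2

/-- For a suitable point `a` of `U` with `f(s, a) = 1` and `f(u, a) = 0`, both `a` and `a + u` lie
in the closure, and `s + u = (s + a) + (a + u)` is reached by two admissible sums. -/
theorem IsFull.gen_add_of_singular {U : Submodule (ZMod 2) V} (hU : IsFull Q X U)
    (hR : IsRich Q U) {s t u z : V} (hs : Gen Q X s) (ht : t ∈ U) (hst : polar Q s t = 1)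
    (hu : u ∈ U) (hQu : Q u = 0) (hsu : polar Q s u = 0) (hz : z ∈ U)
    (hsz : polar Q (s + u) z = 1) : Gen Q X (s + u) := by
  rw [polar_add_left] at hsz
  -- On `U` the functional `f(s, ·)` is neither zero (by `t`) nor equal to `f(u, ·)` (by `z`).
  obtain ⟨a, ha, h1, h2⟩ : ∃ a ∈ U, polar Q s a = 1 ∧ polar Q u a = 0 := by
    rcases zmod2_cases (polar Q u t) with h | h
    · exact ⟨t, ht, hst, h⟩
    · rcases zmod2_cases (polar Q s z) with h' | h'
      · refine ⟨t + z, add_mem ht hz, ?_, ?_⟩ <;> rw [polar_add_right] <;> grind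
      · exact ⟨z, hz, h', by grind⟩
  obtain ⟨a, ha, hQa, h1, h2, hw, hw'⟩ :=
    hR.exists_point (polarBilin Q s) (polarBilin Q u) (u := u) ha h1 h2
  change polar Q s a = 1 at h1
  change polar Q u a = 0 at h2
  have hau : polar Q a u = 0 := by rw [polar_comm, h2]
  have hga : Gen Q X a := hU a ha hQa hw
  have hgau : Gen Q X (a + u) := hU _ (add_mem ha hu) (by
    rw [quadratic_add, hQa, hQu, hau, add_zero, add_zero]) hw'
  have h3 := (hs.add hga h1).add hgau (by
    simp only [polar_add_left, polar_add_right, polar_self_zero, h1, hau, hsu, add_zero])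
  rwa [← add_assoc, add_add_self] at h3

theorem IsFull.gen_add {U : Submodule (ZMod 2) V} (hU : IsFull Q X U)
    (hR : IsRich Q U) (hX : ∀ x ∈ X, Q x = 1) {s t u : V} (hs : Gen Q X s) (ht : t ∈ U)
    (hst : polar Q s t = 1) (hu : u ∈ U) (hQ : Q (s + u) = 1)
    (hz : (∃ z ∈ U, polar Q (s + u) z = 1) ∨ polar Q (s + u) s = 1) : Gen Q X (s + u) := by
  have hQs := hs.quad_eq_one hX
  rw [quadratic_add, hQs] at hQ
  rcases zmod2_cases (polar Q s u) with hsu | hsu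
  · have hz : ∃ z ∈ U, polar Q (s + u) z = 1 := hz.resolve_right (by
      rw [polar_add_left, polar_self_zero, polar_comm, hsu]; decide)
    obtain ⟨z, hz, hsz⟩ := hz
    exact hU.gen_add_of_singular hR hs ht hst hu (by grind) hsu hz hsz
  · have hQu : Q u = 1 := by grind
    by_cases hw : ∃ w ∈ U, polar Q u w = 1
    · exact hs.add (hU u hu hQu hw) hsu
    push Not at hw
    have hw' (x : V) (hx : x ∈ U) : polar Q u x = 0 := by
      by_contra h
      exact hw x hx (zmod2_ne_zero.1 h)
    -- Here `u` lies in the radical of `U`, so fullness says nothing about it. Replacing `s` by `s +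
    -- a` and `u` by `a + u` makes the second vector singular and orthogonal to the first, without
    -- changing the sum.
    obtain ⟨a, ha, hQa, h1, -, hwa, -⟩ :=
      hR.exists_point (polarBilin Q s) 0 (u := 0) ht hst rfl
    change polar Q s a = 1 at h1
    have hua := hw' a ha
    have hau : polar Q a u = 0 := by rw [polar_comm, hua]
    have h2 := hU.gen_add_of_singular hR (hs.add (hU a ha hQa hwa) h1) ha (t := a) (u := a + u)
      (z := t) (by rw [polar_add_left, polar_self_zero, h1, add_zero]) (add_mem ha hu)
      (by rw [quadratic_add, hQa, hQu, hau]; decide)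
      (by simp only [polar_add_left, polar_add_right, polar_self_zero, h1, hau, hsu]; decide) ht
      (by
        rw [← add_assoc, add_add_self, polar_add_left, hst, hw' t ht, add_zero])
    rwa [← add_assoc, add_add_self] at h2

theorem IsFull.sup_span {U : Submodule (ZMod 2) V} (hU : IsFull Q X U)
    (hR : IsRich Q U) (hX : ∀ x ∈ X, Q x = 1) {s t : V} (hs : Gen Q X s) (ht : t ∈ U)
    (hst : polar Q s t = 1) : IsFull Q X (U ⊔ Submodule.span (ZMod 2) {s}) := by
  have hmem (v : V) (hv : v ∈ U ⊔ Submodule.span (ZMod 2) {s}) : v ∈ U ∨ ∃ u ∈ U, v = s + u := by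
    obtain ⟨u, hu, y, hy, rfl⟩ := Submodule.mem_sup.1 hv
    obtain ⟨c, rfl⟩ := Submodule.mem_span_singleton.1 hy
    rcases zmod2_cases c with rfl | rfl
    · left; simpa using hu
    · right; exact ⟨u, hu, by rw [one_smul, add_comm]⟩
  have hpol (v w : V) (hw : w ∈ U ⊔ Submodule.span (ZMod 2) {s}) (h : polar Q v w = 1) :
      (∃ z ∈ U, polar Q v z = 1) ∨ polar Q v s = 1 := by
    rcases hmem w hw with hw | ⟨u, hu, rfl⟩
    · exact .inl ⟨w, hw, h⟩
    · rw [polar_add_right] at h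
      rcases zmod2_cases (polar Q v u) with h1 | h1
      · right; rwa [h1, add_zero] at h
      · exact .inl ⟨u, hu, h1⟩
  intro v hv hQv ⟨w, hw, hvw⟩
  rcases hmem v hv with hv | ⟨u, hu, rfl⟩
  · rcases hpol v w hw hvw with h | h
    · exact hU v hv hQv h
    -- A vector in the radical of `U` may become a point only through `s`; it is then obtained from
    -- `s + v` by removing `s`.
    · have h1 : Gen Q X (s + v) := hU.gen_add hR hX hs ht hst hv
        (by rw [quadratic_add, hs.quad_eq_one hX, hQv, polar_comm, h]; decide)
        (.inr (by rw [polar_add_left, polar_self_zero, h, zero_add]))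
      rw [add_comm] at h1
      exact h1.of_add hs h
  · exact hU.gen_add hR hX hs ht hst hu hQv (hpol _ w hw hvw)

/-- If the closure of the vertices of a connected graph contains all points of a sufficiently large
subspace, then it contains all points. -/
theorem IsFull.gen_of_isPoint {ι : Type*} (G : SimpleGraph ι) (hG : G.Preconnected) (b : ι → V)
    (hb : Submodule.span (ZMod 2) (Set.range b) = ⊤) (hQ : ∀ i, Q (b i) = 1)
    (hadj : ∀ i j, G.Adj i j ↔ polar Q (b i) (b j) = 1) {U : Submodule (ZMod 2) V}
    (hU : IsFull Q (Set.range b) U) (hR : IsRich Q U) {v : V} (hv : IsPoint Q v) :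
    Gen Q (Set.range b) v := by
  have hX : ∀ x ∈ Set.range b, Q x = 1 := by rintro _ ⟨i, rfl⟩; exact hQ i
  obtain ⟨M, hUM, ⟨hM, hMax⟩⟩ := zorn_le_nonempty₀ {U | IsFull Q (Set.range b) U} (by
    intro c hc hchain U0 hU0
    refine ⟨sSup c, ?_, fun z hz => le_sSup hz⟩
    intro v hv hQv ⟨w, hw, hvw⟩
    rw [Submodule.mem_sSup_of_directed ⟨U0, hU0⟩ hchain.directedOn] at hv hw
    obtain ⟨U1, h1, hv⟩ := hv
    obtain ⟨U2, h2, hw⟩ := hw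
    obtain ⟨U3, h3, h13, h23⟩ := hchain.directedOn U1 h1 U2 h2
    exact hc h3 v (h13 hv) hQv ⟨w, h23 hw, hvw⟩) U hU
  have hRM := hR.mono hUM
  -- By maximality, a vertex outside `M` is orthogonal to `M`; otherwise `sup_span` would enlarge
  -- `M`.
  have hdich (i : ι) (hi : b i ∉ M) (t : V) (ht : t ∈ M) : polar Q (b i) t = 0 := by
    by_contra h
    rw [← ne_eq, zmod2_ne_zero] at h
    have h1 := hMax (y := M ⊔ Submodule.span (ZMod 2) {b i})
      (hM.sup_span hRM hX (.base ⟨i, rfl⟩) ht h) le_sup_left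
    exact hi (h1 (Submodule.mem_sup_right (Submodule.mem_span_singleton_self _)))
  -- If all vertices were outside, they would be orthogonal to `M`, and `M` would lie in the
  -- radical, against richness.
  obtain ⟨i, hi⟩ : ∃ i, b i ∈ M := by
    by_contra! h
    obtain ⟨d, hd, hdd⟩ := hRM 0 0 0
    obtain ⟨w, hw, h1⟩ := hdd 0 1 (by decide)
    have h2 : polar Q w (d 0 + d 1) = 0 := by
      rw [polar_comm]
      refine polar_eq_zero_of_mem_span (X := Set.range b) ?_ (by rw [hb]; trivial)
      rintro _ ⟨i, rfl⟩
      rw [polar_comm]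
      exact hdich i (h i) _ (add_mem (hd 0).1 (hd 1).1)
    rw [polar_comm, h1] at h2
    exact absurd h2 (by decide)
  have hall (j : ι) : b j ∈ M := by
    obtain ⟨p⟩ := hG i j
    induction p with
    | nil => exact hi
    | @cons x y z hxy p ih =>
      refine ih ?_
      by_contra hy
      have h1 := hdich _ hy _ hi
      rw [polar_comm, (hadj _ _).1 hxy] at h1
      exact absurd h1 (by decide)
  have htop : M = ⊤ := by
    rw [eq_top_iff, ← hb, Submodule.span_le]
    rintro _ ⟨j, rfl⟩
    exact hall j
  obtain ⟨h1, w, hw⟩ := hv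
  exact hM v (htop ▸ trivial) h1 ⟨w, htop ▸ trivial, zmod2_ne_zero.1 hw⟩

end Extension

/-! ## The six-dimensional space of type `E₆` -/

section ESix

/-- The Gram matrix of the polar form of six vectors of which the first five are pairwise not
orthogonal and the last is not orthogonal to exactly the first three. -/
def e6Gram : Matrix (Fin 6) (Fin 6) (ZMod 2) :=
  !![0, 1, 1, 1, 1, 1; 1, 0, 1, 1, 1, 1; 1, 1, 0, 1, 1, 1; 1, 1, 1, 0, 1, 0; 1, 1, 1, 1, 0, 0;
    1, 1, 1, 0, 0, 0]

/-- The linear functional `polar _ (e_i)` on the coordinate space of type `E₆`. -/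
def e6Pair (α : Fin 6 → ZMod 2) (i : Fin 6) : ZMod 2 :=
  α 0 * e6Gram 0 i + α 1 * e6Gram 1 i + α 2 * e6Gram 2 i + α 3 * e6Gram 3 i + α 4 * e6Gram 4 i +
    α 5 * e6Gram 5 i

/-- The quadratic form on the coordinate space of type `E₆`. -/
def e6Quad (α : Fin 6 → ZMod 2) : ZMod 2 :=
  α 0 * (1 + α 1 + α 2 + α 3 + α 4 + α 5) + α 1 * (1 + α 2 + α 3 + α 4 + α 5) +
    α 2 * (1 + α 3 + α 4 + α 5) + α 3 * (1 + α 4) + α 4 + α 5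

theorem e6Pair_nondegenerate : ∀ α : Fin 6 → ZMod 2, α ≠ 0 → ∃ i, e6Pair α i = 1 := by
  decide +kernel

/-- Induction on the weight: a vector with `Q = 1` loses a coordinate by an admissible sum with a
basis vector. The excluded vector, the sum of the five-clique, is orthogonal to all five of its
summands and admits no such descent, so the descent has to avoid it. -/
theorem e6_descent : ∀ α : Fin 6 → ZMod 2, e6Quad α = 1 → α ≠ ![1, 1, 1, 1, 1, 0] →
    (∃ i, α = Pi.single i 1) ∨
      ∃ i, α i = 1 ∧ e6Pair α i = 1 ∧ α + Pi.single i 1 ≠ ![1, 1, 1, 1, 1, 0] := by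
  decide +kernel

variable {V : Type*} [AddCommGroup V] [Module (ZMod 2) V] {Q : QuadraticForm (ZMod 2) V}

/-- Among the vectors with the property `P` there are six that span a space of type `E₆`. -/
def HasE6 (Q : QuadraticForm (ZMod 2) V) (P : V → Prop) : Prop :=
  ∃ c : Fin 6 → V, (∀ i, P (c i)) ∧ ∀ i j, polar Q (c i) (c j) = e6Gram i j

theorem quad_smul_zmod2 (a : ZMod 2) (v : V) : Q (a • v) = a * Q v := by
  rcases zmod2_cases a with rfl | rfl <;> simp

theorem e6_polar_linearCombination {c : Fin 6 → V}
    (hc : ∀ i j, polar Q (c i) (c j) = e6Gram i j) (α : Fin 6 → ZMod 2) (i : Fin 6) :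
    polar Q (Fintype.linearCombination (ZMod 2) c α) (c i) = e6Pair α i := by
  simp only [Fintype.linearCombination_apply, Fin.sum_univ_six, polar_add_left, polar_smul_left,
    hc, smul_eq_mul, e6Pair]

theorem e6_quad_linearCombination {c : Fin 6 → V} (hQ : ∀ i, Q (c i) = 1)
    (hc : ∀ i j, polar Q (c i) (c j) = e6Gram i j) (α : Fin 6 → ZMod 2) :
    Q (Fintype.linearCombination (ZMod 2) c α) = e6Quad α := by
  simp only [Fintype.linearCombination_apply, Fin.sum_univ_six, quadratic_add, polar_add_left,
    polar_smul_left, polar_smul_right, hc, smul_eq_mul, quad_smul_zmod2, hQ, e6Quad]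
  simp only [e6Gram, Matrix.of_apply, Matrix.cons_val]
  ring

theorem e6_gen {X : Set V} {c : Fin 6 → V} (hX : ∀ x ∈ X, Q x = 1) (hg : ∀ i, Gen Q X (c i))
    (hc : ∀ i j, polar Q (c i) (c j) = e6Gram i j) (α : Fin 6 → ZMod 2) (hα : e6Quad α = 1) :
    Gen Q X (Fintype.linearCombination (ZMod 2) c α) := by
  have hsingle (i : Fin 6) : Fintype.linearCombination (ZMod 2) c (Pi.single i 1) = c i := by simp
  have hQ (i : Fin 6) : Q (c i) = 1 := (hg i).quad_eq_one hX
  have hstep (α : Fin 6 → ZMod 2) (i : Fin 6) (hi : e6Pair α i = 1)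
      (h : Gen Q X (Fintype.linearCombination (ZMod 2) c (α + Pi.single i 1))) :
      Gen Q X (Fintype.linearCombination (ZMod 2) c α) := by
    rw [map_add, hsingle] at h
    exact h.of_add (hg i) (by rw [e6_polar_linearCombination hc, hi])
  have main (n : ℕ) : ∀ α : Fin 6 → ZMod 2, (Finset.univ.filter fun i => α i = 1).card = n →
      e6Quad α = 1 → α ≠ ![1, 1, 1, 1, 1, 0] →
      Gen Q X (Fintype.linearCombination (ZMod 2) c α) := by
    induction n using Nat.strong_induction_on with
    | _ n ih =>
      intro α hn hα hne
      rcases e6_descent α hα hne with ⟨i, rfl⟩ | ⟨i, hi, hp, hne'⟩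
      · rw [hsingle]; exact hg i
      · refine hstep α i hp (ih _ ?_ _ rfl ?_ hne')
        · rw [← hn]
          refine Finset.card_lt_card (Finset.ssubset_iff_subset_ne.2 ⟨?_, ?_⟩)
          · intro j hj
            by_cases hij : j = i
            · subst hij; simpa using hi
            · simpa [Pi.single_apply, hij] using hj
          · intro h
            have h1 : i ∈ Finset.univ.filter fun i => α i = 1 := by simpa using hi
            rw [← h] at h1
            simp [hi] at h1
        · rw [← e6_quad_linearCombination hQ hc, map_add, hsingle, quadratic_add,
            e6_quad_linearCombination hQ hc, e6_polar_linearCombination hc, hα, hp, hQ]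
          decide
  -- The exceptional vector has product one with the last basis vector, so it is reached from above,
  -- from the vector of weight six.
  by_cases hne : α = ![1, 1, 1, 1, 1, 0]
  · subst hne
    exact hstep _ 5 (by decide) (main _ _ rfl (by decide) (by decide))
  · exact main _ α rfl hα hne

theorem e6_isFull {X : Set V} {c : Fin 6 → V} (hX : ∀ x ∈ X, Q x = 1) (hg : ∀ i, Gen Q X (c i))
    (hc : ∀ i j, polar Q (c i) (c j) = e6Gram i j) :
    IsFull Q X (LinearMap.range (Fintype.linearCombination (ZMod 2) c)) := by
  rintro _ ⟨α, rfl⟩ hQ -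
  rw [e6_quad_linearCombination (fun i => (hg i).quad_eq_one hX) hc] at hQ
  exact e6_gen hX hg hc α hQ

/-- In a six-dimensional nondegenerate space, the intersection of two hyperplanes contains a
hyperbolic pair and, orthogonal to it, three different vectors. -/
theorem exists_hyperbolic_of_nondegenerate {E : Type*} [AddCommGroup E] [Module (ZMod 2) E]
    [FiniteDimensional (ZMod 2) E] (hE : Module.finrank (ZMod 2) E = 6)
    (B : LinearMap.BilinForm (ZMod 2) E) (hB : B.Nondegenerate)
    (φ ψ : E →ₗ[ZMod 2] ZMod 2) : ∃ k k' : E, φ k = 0 ∧ ψ k = 0 ∧ φ k' = 0 ∧ ψ k' = 0 ∧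
      B k k' = 1 ∧ ∃ m : Fin 3 → E, Function.Injective m ∧
        ∀ i, φ (m i) = 0 ∧ ψ (m i) = 0 ∧ B (m i) k = 0 ∧ B (m i) k' = 0 := by
  obtain ⟨k, k', h1, h2, h3, h4, h5⟩ : ∃ k k' : E, φ k = 0 ∧ ψ k = 0 ∧ φ k' = 0 ∧ ψ k' = 0 ∧
      B k k' = 1 := by
    by_contra! hcon
    have h1 := LinearMap.finrank_range_add_finrank_ker (φ.prod ψ)
    have h2 : Module.finrank (ZMod 2) (LinearMap.range (φ.prod ψ)) ≤ 2 :=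
      (Submodule.finrank_le _).trans (by simp)
    have h3 := LinearMap.BilinForm.finrank_orthogonal hB (LinearMap.ker (φ.prod ψ))
    have h4 : LinearMap.ker (φ.prod ψ) ≤ B.orthogonal (LinearMap.ker (φ.prod ψ)) := by
      intro x hx y hy
      have hx' := Prod.mk_eq_zero.1 (LinearMap.mem_ker.1 hx)
      have hy' := Prod.mk_eq_zero.1 (LinearMap.mem_ker.1 hy)
      exact zmod2_ne_one.1 (hcon y x hy'.1 hy'.2 hx'.1 hx'.2)
    have h5 := Submodule.finrank_mono h4
    omega
  refine ⟨k, k', h1, h2, h3, h4, h5, ?_⟩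
  -- Four functionals on a space of dimension six leave a kernel of dimension at least two, which
  -- contains `0` and two different nonzero vectors.
  let T := (φ.prod ψ).prod ((B.flip k).prod (B.flip k'))
  have h6 := LinearMap.finrank_range_add_finrank_ker T
  have h7 : Module.finrank (ZMod 2) (LinearMap.range T) ≤ 4 :=
    (Submodule.finrank_le _).trans (by simp)
  have hT (x : E) (hx : x ∈ LinearMap.ker T) : φ x = 0 ∧ ψ x = 0 ∧ B x k = 0 ∧ B x k' = 0 := by
    simpa [T, and_assoc] using hx
  obtain ⟨m, hm, hm0⟩ := Submodule.exists_mem_ne_zero_of_ne_bot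
    (p := LinearMap.ker T) (by
      intro h
      rw [h, finrank_bot] at h6
      omega)
  obtain ⟨m', hm', hm1⟩ := Set.not_subset.1 (show ¬ (LinearMap.ker T : Set E) ⊆
    Submodule.span (ZMod 2) {m} from fun h => by
      have h8 := Submodule.finrank_mono (R := ZMod 2) (M := E) h
      have h9 := finrank_span_singleton (K := ZMod 2) hm0
      omega)
  refine ⟨![0, m, m'], ?_, ?_⟩
  · have hm'0 : m' ≠ 0 := by rintro rfl; exact hm1 (zero_mem _)
    have hmm' : m ≠ m' := by rintro rfl; exact hm1 (Submodule.mem_span_singleton_self _)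
    intro i j hij
    fin_cases i <;> fin_cases j <;> simp_all
  · intro i
    fin_cases i
    · simp
    · exact hT m hm
    · exact hT m' hm'

/-- Each of the three vectors `m i` is corrected by an element of the hyperbolic plane of `k`, `k'`
so that `Q` becomes one. Products with `k` and `k'` recover the correction, so the results stay
different; by nondegeneracy their differences are not in the radical. -/
theorem e6_isRich {c : Fin 6 → V}
    (hc : ∀ i j, polar Q (c i) (c j) = e6Gram i j) :
    IsRich Q (LinearMap.range (Fintype.linearCombination (ZMod 2) c)) := by
  intro φ ψ a
  set π := Fintype.linearCombination (ZMod 2) c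
  let B : LinearMap.BilinForm (ZMod 2) (Fin 6 → ZMod 2) := (polarBilin Q).compl₁₂ π π
  have hB (α β : Fin 6 → ZMod 2) : B α β = polar Q (π α) (π β) := rfl
  have hsingle (i : Fin 6) : π (Pi.single i 1) = c i := by simp [π]
  have hnd (α : Fin 6 → ZMod 2) (hα : α ≠ 0) : ∃ β, B α β = 1 := by
    obtain ⟨i, hi⟩ := e6Pair_nondegenerate α hα
    exact ⟨Pi.single i 1, by rw [hB, hsingle, e6_polar_linearCombination hc, hi]⟩
  have hcomm (α β : Fin 6 → ZMod 2) : B α β = B β α := polar_comm _ _ _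
  have hrefl : B.IsRefl := fun α β h => by rw [hcomm, h]
  obtain ⟨k, k', h1, h2, h3, h4, h5, m, hm, hmk⟩ := exists_hyperbolic_of_nondegenerate
    (E := Fin 6 → ZMod 2) (by simp) B
    ((LinearMap.IsRefl.nondegenerate_iff_separatingLeft hrefl).2 fun α h => by
      by_contra h0
      obtain ⟨β, hβ⟩ := hnd α h0
      rw [h β] at hβ
      exact absurd hβ (by decide)) (φ.comp π) (ψ.comp π)
  -- The four values of `Q` on a coset of the hyperbolic plane add up to `f(k, k') = 1`, so they do
  -- not all vanish.
  have hkey (i : Fin 3) : ∃ x y : ZMod 2, Q (a + π (m i + x • k + y • k')) = 1 := by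
    by_contra! hcon
    have q0 := zmod2_ne_one.1 (hcon 0 0)
    have q1 := zmod2_ne_one.1 (hcon 0 1)
    have q2 := zmod2_ne_one.1 (hcon 1 0)
    have q3 := zmod2_ne_one.1 (hcon 1 1)
    simp only [map_add, zero_smul, one_smul, add_zero, quadratic_add, polar_add_right,
      polar_add_left, ← hB] at q0 q1 q2 q3
    grind
  choose x y hxy using hkey
  refine ⟨fun i => π (m i + x i • k + y i • k'), fun i => ⟨⟨_, rfl⟩, ?_, ?_, hxy i⟩,
    fun i j hij => ?_⟩
  · have := (hmk i).1
    simp_all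
  · have := (hmk i).2.1
    simp_all
  · obtain ⟨β, hβ⟩ := hnd ((m i + x i • k + y i • k') + (m j + x j • k + y j • k')) (by
      intro h0
      have hself (α : Fin 6 → ZMod 2) : B α α = 0 := polar_self_zero Q (π α)
      have hk : x i = x j ∧ y i = y j := by
        have e1 := congrArg (fun α => B α k) h0
        have e2 := congrArg (fun α => B α k') h0
        have h5' : B k' k = 1 := by rw [hcomm, h5]
        simp only [map_add, LinearMap.add_apply, map_smul, LinearMap.smul_apply, (hmk _).2.2.1,
          (hmk _).2.2.2, hself, h5, h5', smul_eq_mul, map_zero, LinearMap.zero_apply] at e1 e2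
        constructor <;> grind
      rw [hk.1, hk.2] at h0
      apply hij
      apply hm
      have h6 : m i + m j = 0 := by
        rw [← h0, show m i + x j • k + y j • k' + (m j + x j • k + y j • k') =
          m i + m j + (x j • k + x j • k) + (y j • k' + y j • k') by abel,
          ZModModule.add_self (x j • k), ZModModule.add_self (y j • k'), add_zero, add_zero]
      rw [add_eq_zero_iff_eq_neg, ZModModule.neg_eq_self] at h6
      exact h6)
    exact ⟨π β, ⟨β, rfl⟩, by rw [← map_add]; exact hβ⟩

/-- If the closure of the vertices of a connected graph contains a basis of a space of type `E₆`,
then it consists of all points. -/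
theorem gen_of_isPoint_of_hasE6 {ι : Type*} (G : SimpleGraph ι) (hG : G.Preconnected) (b : ι → V)
    (hb : Submodule.span (ZMod 2) (Set.range b) = ⊤) (hQ : ∀ i, Q (b i) = 1)
    (hadj : ∀ i j, G.Adj i j ↔ polar Q (b i) (b j) = 1)
    (h6 : HasE6 Q (Gen Q (Set.range b))) {v : V} (hv : IsPoint Q v) :
    Gen Q (Set.range b) v := by
  have hX : ∀ x ∈ Set.range b, Q x = 1 := by rintro _ ⟨i, rfl⟩; exact hQ i
  obtain ⟨c, hg, hc⟩ := h6
  exact (e6_isFull hX hg hc).gen_of_isPoint G hG b hb hQ hadj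
    (e6_isRich hc) hv

end ESix

/-! ## Line graphs -/

section LineGraph

/-- The parity of the number of common elements of two pairs. -/
theorem pair_parity {Ω : Type*} [DecidableEq Ω] {a b c d : Ω} (hab : a ≠ b) (hcd : c ≠ d) :
    ((if a = c then 1 else 0) + (if a = d then 1 else 0) + (if b = c then 1 else 0) +
      (if b = d then 1 else 0) : ZMod 2) = 1 ↔
      s(a, b) ≠ s(c, d) ∧ ∃ o, o ∈ s(a, b) ∧ o ∈ s(c, d) := by
  have h2 : (1 + 1 : ZMod 2) ≠ 1 := by decide
  have hex : (∃ o, o ∈ s(a, b) ∧ o ∈ s(c, d)) ↔ a = c ∨ a = d ∨ b = c ∨ b = d := by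
    simp only [Sym2.mem_iff]
    constructor
    · rintro ⟨o, rfl | rfl, rfl | rfl⟩ <;> simp
    · rintro (h | h | h | h)
      · exact ⟨a, .inl rfl, .inl h⟩
      · exact ⟨a, .inl rfl, .inr h⟩
      · exact ⟨b, .inr rfl, .inl h⟩
      · exact ⟨b, .inr rfl, .inr h⟩
  rw [hex, ne_eq, Sym2.eq_iff]
  by_cases h1 : a = c <;> by_cases h3 : a = d <;> by_cases h4 : b = c <;> by_cases h5 : b = d <;>
    simp_all

theorem isLineGraph_of_pairs {ι Ω : Type u} (G : SimpleGraph ι) (p : ι → Sym2 Ω)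
    (hp : Function.Injective p) (hd : ∀ i, ¬ (p i).IsDiag)
    (hadj : ∀ i j, G.Adj i j ↔ p i ≠ p j ∧ ∃ o, o ∈ p i ∧ o ∈ p j) : IsLineGraph G := by
  have hE : (SimpleGraph.fromEdgeSet (Set.range p)).edgeSet = Set.range p := by
    rw [SimpleGraph.edgeSet_fromEdgeSet, sdiff_eq_left, Set.disjoint_left]
    rintro _ ⟨i, rfl⟩ h
    exact hd i h
  refine ⟨Ω, SimpleGraph.fromEdgeSet (Set.range p),
    ⟨⟨(Equiv.ofInjective p hp).trans (Equiv.setCongr hE.symm), ?_⟩⟩⟩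
  intro i j
  rw [hadj]
  simp only [SimpleGraph.lineGraph, ne_eq, Subtype.ext_iff]
  rfl

/-- This is the line graph of a star, whose centre is `none`. -/
theorem isLineGraph_of_complete {ι : Type u} (G : SimpleGraph ι) (h : ∀ i j, i ≠ j → G.Adj i j) :
    IsLineGraph G := by
  refine isLineGraph_of_pairs (Ω := Option ι) G (fun i => s(none, some i)) ?_ ?_ ?_
  · intro i j hij
    simpa using hij
  · simp
  · intro i j
    constructor
    · intro hij
      exact ⟨by simpa using hij.ne, none, by simp, by simp⟩
    · rintro ⟨hij, -⟩
      exact h i j (by rintro rfl; exact hij rfl)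

/-- Without an induced path of length two, being equal or adjacent would propagate along walks. -/
theorem exists_not_adj_of_not_complete {ι : Type*} (G : SimpleGraph ι) (hG : G.Preconnected)
    {i j : ι} (hij : i ≠ j) (hadj : ¬ G.Adj i j) :
    ∃ x y z, x ≠ y ∧ ¬ G.Adj x y ∧ G.Adj x z ∧ G.Adj z y := by
  by_contra! hcon
  obtain ⟨p⟩ := hG i j
  have main : i = j ∨ G.Adj i j := by
    induction p with
    | nil => exact .inl rfl
    | @cons x y z hxy p ih =>
      clear hij hadj
      by_cases hxz : x = z
      · exact .inl hxz
      · by_cases hyz : y = z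
        · subst hyz; exact .inr hxy
        · by_cases hyz' : G.Adj y z
          · by_contra! h
            exact hcon x z y hxz h.2 hxy hyz'
          · rcases ih hyz hyz' with h | h
            · exact absurd h hyz
            · exact absurd h hyz'
  exact main.elim hij hadj

end LineGraph

/-! ## Cliques in the closure -/

section Clique

variable {V : Type u} [AddCommGroup V] [Module (ZMod 2) V] {Q : QuadraticForm (ZMod 2) V}

theorem hasE6_of_clique {P : V → Prop} {y : Fin 5 → V} {z : V} (hy : ∀ i, P (y i)) (hz : P z)
    (h : ∀ i j, i ≠ j → polar Q (y i) (y j) = 1) (h0 : polar Q z (y 0) = 1)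
    (h1 : polar Q z (y 1) = 1) (h2 : polar Q z (y 2) = 1) (h3 : polar Q z (y 3) = 0)
    (h4 : polar Q z (y 4) = 0) : HasE6 Q P := by
  refine ⟨![y 0, y 1, y 2, y 3, y 4, z], ?_, ?_⟩
  · simp [Fin.forall_fin_succ, hy, hz]
  · have h0' := (polar_comm Q (y 0) z).trans h0
    have h1' := (polar_comm Q (y 1) z).trans h1
    have h2' := (polar_comm Q (y 2) z).trans h2
    have h3' := (polar_comm Q (y 3) z).trans h3
    have h4' := (polar_comm Q (y 4) z).trans h4
    simp [-QuadraticMap.polar_self, Fin.forall_fin_succ, e6Gram, h0, h1, h2, h3, h4, h0', h1', h2', h3', h4',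
      polar_self_zero, h]

/-- The vectors `v` and `0` that correspond to the elements of a clique and one further element. -/
def cliqueVec (C : Set V) (a : Option C) : V := a.elim 0 Subtype.val

variable {C : Set V}

open Classical in
theorem polar_cliqueVec (hC : ∀ v ∈ C, ∀ w ∈ C, v ≠ w → polar Q v w = 1) (a b c d : Option C) :
    polar Q (cliqueVec C a + cliqueVec C b) (cliqueVec C c + cliqueVec C d) =
      (if a = c then 1 else 0) + (if a = d then 1 else 0) + (if b = c then 1 else 0) +
        (if b = d then 1 else 0) := by
  -- The terms besides the first depend on at most one of the two arguments, so they cancel in the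
  -- sum over both elements of each pair.
  have h1 (a c : Option C) : polar Q (cliqueVec C a) (cliqueVec C c) =
      (if a = c then 1 else 0) + 1 + (if a = none then 0 else 1) +
        (if c = none then 0 else 1) := by
    rcases a with _ | ⟨a, ha⟩ <;> rcases c with _ | ⟨c, hc⟩
    · simp [cliqueVec]; decide
    · simp [cliqueVec]; decide
    · simp [cliqueVec]; decide
    · by_cases h : a = c
      · subst h
        simp [-QuadraticMap.polar_self, cliqueVec, polar_self_zero]; decide
      · simp [cliqueVec, h, hC a ha c hc h]; decide
  simp only [polar_add_left, polar_add_right, h1]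
  grind

variable {X : Set V}

theorem gen_cliqueVec_add (hg : ∀ v ∈ C, Gen Q X v)
    (hC : ∀ v ∈ C, ∀ w ∈ C, v ≠ w → polar Q v w = 1) {a b : Option C} (hab : a ≠ b) :
    Gen Q X (cliqueVec C a + cliqueVec C b) := by
  rcases a with _ | ⟨a, ha⟩ <;> rcases b with _ | ⟨b, hb⟩
  · exact absurd rfl hab
  · simpa [cliqueVec] using hg b hb
  · simpa [cliqueVec] using hg a ha
  · exact (hg a ha).add (hg b hb) (hC a ha b hb (by rintro rfl; exact hab rfl))

/-- A vector of the closure is orthogonal to a maximal clique `C`, or it has the same products as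
a pair of elements of `C ∪ {0}`. -/
theorem clique_dichotomy (hg : ∀ v ∈ C, Gen Q X v)
    (hC : ∀ v ∈ C, ∀ w ∈ C, v ≠ w → polar Q v w = 1)
    (hmax : ∀ x, Gen Q X x → ¬ ∀ c ∈ C, polar Q x c = 1)
    (h6 : ¬ HasE6 Q (Gen Q X)) {s : V} (hs : Gen Q X s) :
    (∀ c ∈ C, polar Q s c = 0) ∨ ∃ a b : Option C, a ≠ b ∧
      ∀ c ∈ C, polar Q s c = polar Q (cliqueVec C a + cliqueVec C b) c := by
  by_cases hA : ∃ a₁ ∈ C, ∃ a₂ ∈ C, ∃ a₃ ∈ C, a₁ ≠ a₂ ∧ a₁ ≠ a₃ ∧ a₂ ≠ a₃ ∧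
      polar Q s a₁ = 1 ∧ polar Q s a₂ = 1 ∧ polar Q s a₃ = 1
  · right
    obtain ⟨a₁, ha₁, a₂, ha₂, a₃, ha₃, h12, h13, h23, h1, h2, h3⟩ := hA
    -- Maximality provides one element `d` of `C` orthogonal to `s`. A second one, with `d`, the
    -- three `aᵢ` and `s`, would give an `E₆`; so `s` behaves like the pair `{0, d}`.
    obtain ⟨d, hd, h4⟩ : ∃ d ∈ C, polar Q s d = 0 := by
      have h4 := hmax s hs
      push Not at h4
      obtain ⟨d, hd, h4⟩ := h4
      exact ⟨d, hd, zmod2_ne_one.1 h4⟩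
    refine ⟨none, some ⟨d, hd⟩, by simp, fun c hc => ?_⟩
    simp only [cliqueVec, Option.elim, zero_add]
    by_cases hcd : d = c
    · subst hcd; rw [h4, polar_self_zero]
    · rw [hC d hd c hc hcd]
      by_contra h5
      rw [← ne_eq, zmod2_ne_one] at h5
      have hne {x y : V} (hx : polar Q s x = 1) (hy : polar Q s y = 0) : x ≠ y := by
        rintro rfl
        rw [hx] at hy
        exact absurd hy (by decide)
      refine h6 (hasE6_of_clique (y := ![a₁, a₂, a₃, d, c]) (z := s) ?_ hs ?_ h1 h2 h3 h4 h5)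
      · simp [Fin.forall_fin_succ, hg, ha₁, ha₂, ha₃, hd, hc]
      · simp [Fin.forall_fin_succ, hC, ha₁, ha₂, ha₃, hd, hc, h12, h13, h23, h12.symm, h13.symm,
          h23.symm, hcd, Ne.symm hcd, hne h1 h4, hne h2 h4, hne h3 h4, hne h1 h5, hne h2 h5,
          hne h3 h5, (hne h1 h4).symm, (hne h2 h4).symm, (hne h3 h4).symm, (hne h1 h5).symm,
          (hne h2 h5).symm, (hne h3 h5).symm]
  · by_cases h0 : ∀ c ∈ C, polar Q s c = 0
    · exact .inl h0
    right
    push Not at h0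
    obtain ⟨a, ha, h1⟩ := h0
    rw [zmod2_ne_zero] at h1
    -- Now `s` has product one with at most two elements of `C`. Maximality applied to `s + a`
    -- yields the second, `b`, and `s` behaves like `{a, b}`.
    have h2 := hmax (s + a) (hs.add (hg a ha) h1)
    push Not at h2
    obtain ⟨b, hb, h2⟩ := h2
    rw [zmod2_ne_one, polar_add_left] at h2
    have hab : a ≠ b := by
      rintro rfl
      rw [polar_self_zero, h1] at h2
      exact absurd h2 (by decide)
    rw [hC a ha b hb hab] at h2
    have h3 : polar Q s b = 1 := by grind
    refine ⟨some ⟨a, ha⟩, some ⟨b, hb⟩, by simpa using hab, fun c hc => ?_⟩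
    simp only [cliqueVec, Option.elim, polar_add_left]
    by_cases hac : a = c
    · subst hac; rw [h1, polar_self_zero, hC b hb a ha hab.symm]; rfl
    by_cases hbc : b = c
    · subst hbc; rw [h3, polar_self_zero, hC a ha b hb hab]; rfl
    rw [hC a ha c hc hac, hC b hb c hc hbc]
    by_contra h4
    push Not at hA
    exact hA a ha b hb c hc hab hac hbc h1 h3 (zmod2_ne_zero.1 h4)

theorem polar_cliqueVec_eq {s t : V} (h : ∀ c ∈ C, polar Q s c = polar Q t c) (o : Option C) :
    polar Q s (cliqueVec C o) = polar Q t (cliqueVec C o) := by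
  rcases o with _ | ⟨c, hc⟩
  · simp [cliqueVec]
  · exact h c hc

/-- The vectors `x` and `x + c i + r` form a five-clique. Among them `c 0` is orthogonal exactly to
`x` and `x + c 0 + r`. -/
theorem hasE6_of_orthogonal {x r : V} {c : Fin 4 → V} (hx : Gen Q X x)
    (hc : ∀ i, Gen Q X (c i)) (hcr : ∀ i, Gen Q X (c i + r))
    (hcc : ∀ i j, i ≠ j → polar Q (c i) (c j) = 1) (hxc : ∀ i, polar Q x (c i) = 0)
    (hrc : ∀ i, polar Q r (c i) = 0) (hxr : polar Q x r = 1) : HasE6 Q (Gen Q X) := by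
  have hcx (i) : polar Q (c i) x = 0 := by rw [polar_comm, hxc]
  have hcr' (i) : polar Q (c i) r = 0 := by rw [polar_comm, hrc]
  have hrx : polar Q r x = 1 := by rw [polar_comm, hxr]
  have hz (i) : Gen Q X (x + (c i + r)) :=
    hx.add (hcr i) (by rw [polar_add_right, hxc, hxr, zero_add])
  refine hasE6_of_clique
    (y := ![x + (c 1 + r), x + (c 2 + r), x + (c 3 + r), x, x + (c 0 + r)]) (z := c 0)
    (by simp [Fin.forall_fin_succ, hz, hx]) (hc 0) ?_ ?_ ?_ ?_ ?_ ?_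
  · simp [-QuadraticMap.polar_self, Fin.forall_fin_succ, polar_add_left, polar_add_right, polar_self_zero, hcc, hxc, hrc,
      hxr, hcx, hcr', hrx]
    decide
  all_goals simp [-QuadraticMap.polar_self, polar_add_right, polar_self_zero, hcc, hcx, hcr']

/-- One element of the pair is exchanged at a time: pairs sharing exactly one element are
non-orthogonal, and `r` does not affect the products. -/
theorem gen_cliqueVec_add_relocate (hg : ∀ v ∈ C, Gen Q X v)
    (hC : ∀ v ∈ C, ∀ w ∈ C, v ≠ w → polar Q v w = 1) {r : V}
    (hr : ∀ o, polar Q r (cliqueVec C o) = 0) {a b : Option C} (hab : a ≠ b)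
    (h : Gen Q X (cliqueVec C a + cliqueVec C b + r)) {c d : Option C} (hcd : c ≠ d) :
    Gen Q X (cliqueVec C c + cliqueVec C d + r) := by
  classical
  have step {a b d : Option C} (hab : a ≠ b) (hdb : d ≠ b)
      (h : Gen Q X (cliqueVec C a + cliqueVec C b + r)) :
      Gen Q X (cliqueVec C d + cliqueVec C b + r) := by
    by_cases had : a = d
    · rwa [← had]
    have h1 := h.add (gen_cliqueVec_add hg hC had) (by
      rw [polar_add_left, polar_cliqueVec hC, polar_add_right, hr, hr]
      simp [hab.symm, had, hdb.symm])
    convert h1 using 1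
    rw [show cliqueVec C a + cliqueVec C b + r + (cliqueVec C a + cliqueVec C d) =
      cliqueVec C d + cliqueVec C b + r + (cliqueVec C a + cliqueVec C a) by abel,
      ZModModule.add_self, add_zero]
  have flip {a b : Option C} (h : Gen Q X (cliqueVec C a + cliqueVec C b + r)) :
      Gen Q X (cliqueVec C b + cliqueVec C a + r) := by rwa [add_comm (cliqueVec C b)]
  by_cases hcb : c = b
  · subst hcb
    exact flip (step hab hcd.symm h)
  · have h1 := flip (step hab hcb h)
    exact flip (step (Ne.symm hcb) hcd.symm h1)

/-- If a vector of the closure has the same products with a maximal clique as a pair, then it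
differs from this pair by a vector in the radical. -/
theorem clique_radical (hg : ∀ v ∈ C, Gen Q X v)
    (hC : ∀ v ∈ C, ∀ w ∈ C, v ≠ w → polar Q v w = 1)
    (hmax : ∀ x, Gen Q X x → ¬ ∀ c ∈ C, polar Q x c = 1)
    {k : Fin 4 → V} (hk : ∀ i, k i ∈ C) (hkinj : Function.Injective k)
    (h6 : ¬ HasE6 Q (Gen Q X)) {s : V} (hs : Gen Q X s) {a b : Option C} (hab : a ≠ b)
    (h : ∀ c ∈ C, polar Q s c = polar Q (cliqueVec C a + cliqueVec C b) c) {x : V}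
    (hx : Gen Q X x) : polar Q x (s + (cliqueVec C a + cliqueVec C b)) = 0 := by
  classical
  set r := s + (cliqueVec C a + cliqueVec C b) with hrdef
  have hr (o : Option C) : polar Q r (cliqueVec C o) = 0 := by
    rw [hrdef, polar_add_left, polar_cliqueVec_eq h, ZModModule.add_self]
  have hrs : cliqueVec C a + cliqueVec C b + r = s := by
    rw [hrdef, add_comm, add_add_self]
  have hreloc {c d : Option C} (hcd : c ≠ d) : Gen Q X (cliqueVec C c + cliqueVec C d + r) :=
    gen_cliqueVec_add_relocate hg hC hr hab (by rwa [hrs]) hcd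
  -- Relocation to the pairs `{0, k i}` puts all `k i + r` into the closure, as
  -- `hasE6_of_orthogonal` needs.
  have horth {x : V} (hx : Gen Q X x) (hxc : ∀ c ∈ C, polar Q x c = 0) : polar Q x r = 0 := by
    by_contra h1
    rw [← ne_eq, zmod2_ne_zero] at h1
    refine h6 (hasE6_of_orthogonal hx (fun i => hg _ (hk i)) (fun i => ?_)
      (fun i j hij => hC _ (hk i) _ (hk j) (hkinj.ne hij)) (fun i => hxc _ (hk i))
      (fun i => hr (some ⟨k i, hk i⟩)) h1)
    have h2 := hreloc (c := none) (d := some ⟨k i, hk i⟩) (by simp)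
    simpa [cliqueVec] using h2
  rcases clique_dichotomy hg hC hmax h6 hx with hxc | ⟨c, d, hcd, hxc⟩
  · exact horth hx hxc
  · by_contra h1
    rw [← ne_eq, zmod2_ne_zero] at h1
    have hrt : polar Q (cliqueVec C c + cliqueVec C d) r = 0 := by
      rw [polar_comm, polar_add_right, hr, hr, add_zero]
    have hxt : polar Q x (cliqueVec C c + cliqueVec C d) = 0 := by
      rw [polar_add_right, polar_cliqueVec_eq hxc, polar_cliqueVec_eq hxc, ← polar_add_right,
        polar_self_zero]
    -- Adding the relocated pair `{c, d}` to `x` cancels its products with `C` and keeps its product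
    -- with `r`, which reduces to the orthogonal case.
    have h2 := horth (hx.add (hreloc hcd) (by rw [polar_add_right, hxt, h1, zero_add]))
      (fun e he => by
        rw [polar_add_left, polar_add_left, hxc e he, show polar Q r e = 0 from hr (some ⟨e, he⟩),
          add_zero, ZModModule.add_self])
    rw [polar_add_left, polar_add_left, h1, hrt, polar_self_zero] at h2
    exact absurd h2 (by decide)

/-- Every vertex is, modulo the radical, the sum of a pair in `C ∪ {0}`, so adjacency means sharing
exactly one element. Vertices with the same pair would be twins. -/
theorem isLineGraph_of_clique {ι : Type u} (G : SimpleGraph ι) (hG : G.Preconnected) (b : ι → V)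
    (hb : Submodule.span (ZMod 2) (Set.range b) = ⊤)
    (hadj : ∀ i j, G.Adj i j ↔ polar Q (b i) (b j) = 1)
    (htwin : ∀ i j, (∀ k, G.Adj i k ↔ G.Adj j k) → i = j)
    (h6 : ¬ HasE6 Q (Gen Q (Set.range b)))
    (hg : ∀ v ∈ C, Gen Q (Set.range b) v)
    (hC : ∀ v ∈ C, ∀ w ∈ C, v ≠ w → polar Q v w = 1)
    (hmax : ∀ x, Gen Q (Set.range b) x → ¬ ∀ c ∈ C, polar Q x c = 1)
    {k : Fin 4 → V} (hk : ∀ i, k i ∈ C) (hkinj : Function.Injective k) : IsLineGraph G := by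
  classical
  have hgb (i : ι) : Gen Q (Set.range b) (b i) := .base ⟨i, rfl⟩
  have hdich (i : ι) := clique_dichotomy hg hC hmax h6 (hgb i)
  have hrad {i : ι} {a d : Option C} (had : a ≠ d)
      (h : ∀ c ∈ C, polar Q (b i) c = polar Q (cliqueVec C a + cliqueVec C d) c) (y : V) :
      polar Q (b i) y = polar Q (cliqueVec C a + cliqueVec C d) y := by
    have h1 : polar Q (b i + (cliqueVec C a + cliqueVec C d)) y = 0 := by
      refine polar_eq_zero_of_mem_span (X := Set.range b) ?_ (by rw [hb]; trivial)
      rintro _ ⟨j, rfl⟩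
      rw [polar_comm]
      exact clique_radical hg hC hmax hk hkinj h6 (hgb i) had h (hgb j)
    rw [polar_add_left] at h1
    grind
  obtain ⟨i₀, hi₀⟩ : ∃ i, ¬ ∀ c ∈ C, polar Q (b i) c = 0 := by
    by_contra! h
    have h1 : polar Q (k 0) (k 1) = 0 := by
      refine polar_eq_zero_of_mem_span (X := Set.range b) ?_ (by rw [hb]; trivial)
      rintro _ ⟨j, rfl⟩
      rw [polar_comm]
      exact h j _ (hk 0)
    rw [hC _ (hk 0) _ (hk 1) (hkinj.ne (by decide))] at h1
    exact absurd h1 (by decide)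
  -- A vertex orthogonal to `C` is orthogonal to all pairs, hence to every vertex that is a pair
  -- modulo the radical; connectedness rules it out.
  have hall (j : ι) : ¬ ∀ c ∈ C, polar Q (b j) c = 0 := by
    obtain ⟨p⟩ := hG i₀ j
    induction p with
    | nil => exact hi₀
    | @cons x y z hxy p ih =>
      refine ih fun hy => ?_
      obtain ⟨a, d, had, h⟩ := (hdich x).resolve_left hi₀
      have h1 := (hadj x y).1 hxy
      rw [hrad had h, polar_comm, polar_add_right,
        polar_cliqueVec_eq (s := b y) (t := 0) (by simpa using hy) a,
        polar_cliqueVec_eq (s := b y) (t := 0) (by simpa using hy) d] at h1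
      simp at h1
  choose a d had h using fun j => (hdich j).resolve_left (hall j)
  have hkey (i j : ι) : G.Adj i j ↔ s(a i, d i) ≠ s(a j, d j) ∧
      ∃ o, o ∈ s(a i, d i) ∧ o ∈ s(a j, d j) := by
    rw [hadj, hrad (had i) (h i), polar_comm, hrad (had j) (h j), polar_comm, polar_cliqueVec hC,
      pair_parity (had i) (had j)]
  refine isLineGraph_of_pairs G (fun j => s(a j, d j)) ?_ (fun i => by simpa using had i) hkey
  intro i j hij
  refine htwin i j fun l => ?_
  rw [hkey, hkey, show s(a i, d i) = s(a j, d j) from hij]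

theorem exists_maximal_clique {c : Fin 4 → V} (hg : ∀ i, Gen Q X (c i))
    (hc : ∀ i j, i ≠ j → polar Q (c i) (c j) = 1) : ∃ C : Set V, (∀ v ∈ C, Gen Q X v) ∧
      (∀ v ∈ C, ∀ w ∈ C, v ≠ w → polar Q v w = 1) ∧
      (∀ x, Gen Q X x → ¬ ∀ c ∈ C, polar Q x c = 1) ∧ ∀ i, c i ∈ C := by
  obtain ⟨C, hcC, ⟨⟨hC1, hC2⟩, hmax⟩⟩ := zorn_subset_nonempty
    {C : Set V | (∀ v ∈ C, Gen Q X v) ∧ ∀ v ∈ C, ∀ w ∈ C, v ≠ w → polar Q v w = 1} (by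
      intro c hc hchain hne
      refine ⟨⋃₀ c, ⟨?_, ?_⟩, fun s hs => Set.subset_sUnion_of_mem hs⟩
      · rintro v ⟨s, hs, hv⟩
        exact (hc hs).1 v hv
      · rintro v ⟨s, hs, hv⟩ w ⟨t, ht, hw⟩ hvw
        rcases hchain.total hs ht with h | h
        · exact (hc ht).2 v (h hv) w hw hvw
        · exact (hc hs).2 v hv w (h hw) hvw) (Set.range c) ⟨by
      rintro _ ⟨i, rfl⟩; exact hg i, by
      rintro _ ⟨i, rfl⟩ _ ⟨j, rfl⟩ hij
      exact hc i j (by rintro rfl; exact hij rfl)⟩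
  refine ⟨C, hC1, hC2, fun x hx h => ?_, fun i => hcC ⟨i, rfl⟩⟩
  have hxC : x ∈ C := by
    refine hmax (y := insert x C) ⟨?_, ?_⟩ (Set.subset_insert x C) (Set.mem_insert x C)
    · rintro v (rfl | hv)
      · exact hx
      · exact hC1 v hv
    · rintro v (rfl | hv) w (rfl | hw) hvw
      · exact absurd rfl hvw
      · exact h w hw
      · rw [polar_comm]; exact h v hv
      · exact hC2 v hv w hw hvw
  have h1 := h x hxC
  rw [polar_self_zero] at h1
  exact absurd h1 (by decide)

/-- Take an induced path `x, z, y` and a vertex `t` that is adjacent to `x` but not to `y` (after a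
possible exchange). If `t` is adjacent to `z`, then `x`, `t`, `z`, `z + y` is a clique. Otherwise
`t, x, z, y` is an induced path, and its partial sums form a clique. -/
theorem exists_clique_of_not_complete {ι : Type*} (G : SimpleGraph ι) (hG : G.Preconnected)
    (b : ι → V) (hadj : ∀ i j, G.Adj i j ↔ polar Q (b i) (b j) = 1)
    (htwin : ∀ i j, (∀ k, G.Adj i k ↔ G.Adj j k) → i = j)
    (hnc : ¬ ∀ i j, i ≠ j → G.Adj i j) : ∃ c : Fin 4 → V,
      (∀ i, Gen Q (Set.range b) (c i)) ∧ ∀ i j, i ≠ j → polar Q (c i) (c j) = 1 := by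
  have hgb (i : ι) : Gen Q (Set.range b) (b i) := .base ⟨i, rfl⟩
  have key (x y z t : ι) (hxy : ¬ G.Adj x y) (hxz : G.Adj x z) (hzy : G.Adj z y)
      (htx : G.Adj t x) (hty : ¬ G.Adj t y) : ∃ c : Fin 4 → V,
      (∀ i, Gen Q (Set.range b) (c i)) ∧ ∀ i j, i ≠ j → polar Q (c i) (c j) = 1 := by
    by_cases htz : G.Adj t z
    · rw [hadj] at *
      rw [← ne_eq, zmod2_ne_one] at hxy hty
      rw [polar_comm] at hxz hzy htx hty hxy htz
      have gzy := (hgb z).add (hgb y) (by rw [polar_comm, hzy])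
      refine ⟨![b x, b t, b z, b z + b y], by simp [Fin.forall_fin_succ, hgb, gzy], ?_⟩
      have := polar_comm Q
      simp [-QuadraticMap.polar_self, Fin.forall_fin_succ, polar_add_left, polar_add_right, polar_self_zero]
      grind
    · rw [hadj] at *
      rw [← ne_eq, zmod2_ne_one] at hxy hty htz
      have g1 := (hgb t).add (hgb x) htx
      have g2 := g1.add (hgb z) (by rw [polar_add_left, htz, hxz, zero_add])
      have g3 := g2.add (hgb y) (by
        rw [polar_add_left, polar_add_left, hty, hxy, hzy, zero_add, zero_add])
      refine ⟨![b t, b t + b x, b t + b x + b z, b t + b x + b z + b y],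
        by simp [Fin.forall_fin_succ, hgb, g1, g2, g3], ?_⟩
      have := polar_comm Q
      simp [-QuadraticMap.polar_self, Fin.forall_fin_succ, polar_add_left, polar_add_right, polar_self_zero]
      grind
  push Not at hnc
  obtain ⟨i, j, hij, hnadj⟩ := hnc
  obtain ⟨x, y, z, hxy, hnxy, hxz, hzy⟩ := exists_not_adj_of_not_complete G hG hij hnadj
  obtain ⟨t, ht⟩ : ∃ t, ¬ (G.Adj x t ↔ G.Adj y t) := by
    by_contra! h
    exact hxy (htwin x y h)
  by_cases h1 : G.Adj x t
  · have h2 : ¬ G.Adj y t := by tauto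
    exact key x y z t hnxy hxz hzy h1.symm (fun h => h2 h.symm)
  · have h2 : G.Adj y t := by tauto
    exact key y x z t (fun h => hnxy h.symm) hzy.symm hxz.symm h2.symm (fun h => h1 h.symm)

/-- The closure of the vertices of a connected graph without twins, which is not a line graph,
consists of all points. -/
theorem gen_of_isPoint_of_not_isLineGraph {ι : Type u} (G : SimpleGraph ι) (hG : G.Preconnected)
    (b : ι → V) (hb : Submodule.span (ZMod 2) (Set.range b) = ⊤) (hQ : ∀ i, Q (b i) = 1)
    (hadj : ∀ i j, G.Adj i j ↔ polar Q (b i) (b j) = 1)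
    (htwin : ∀ i j, (∀ k, G.Adj i k ↔ G.Adj j k) → i = j) (hline : ¬ IsLineGraph G) {v : V}
    (hv : IsPoint Q v) : Gen Q (Set.range b) v := by
  refine gen_of_isPoint_of_hasE6 G hG b hb hQ hadj ?_ hv
  by_contra h6
  obtain ⟨c, hg, hc⟩ := exists_clique_of_not_complete G hG b hadj htwin
    (fun h => hline (isLineGraph_of_complete G h))
  obtain ⟨C, hC1, hC2, hmax, hk⟩ := exists_maximal_clique hg hc
  refine hline (isLineGraph_of_clique G hG b hb hadj htwin h6 hC1 hC2 hmax hk ?_)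
  intro i j hij
  by_contra hne
  have h1 := hc i j hne
  rw [hij, polar_self_zero] at h1
  exact absurd h1 (by decide)

end Clique

/-! ## Lines of cotriangular spaces, twins -/

section Cotriangular

variable {V : Type*} [AddCommGroup V] [Module (ZMod 2) V] {Q : QuadraticForm (ZMod 2) V}

theorem isPoint_of_polar {v w : V} (hv : Q v = 1) (h : polar Q v w = 1) : IsPoint Q v :=
  ⟨hv, w, zmod2_ne_zero.2 h⟩

theorem isPoint_add {v w : V} (hv : Q v = 1) (hw : Q w = 1) (h : polar Q v w = 1) :
    IsPoint Q (v + w) :=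
  isPoint_of_polar (w := w) (by rw [quadratic_add, hv, hw, h]; decide)
    (by rw [polar_add_left, polar_self_zero, h, add_zero])

theorem polar_of_mem_line {l : Set {v : V // IsPoint Q v}} (hl : l ∈ (cotri Q).lines) {p q : V}
    (hp : p ∈ Subtype.val '' l) (hq : q ∈ Subtype.val '' l) (hpq : p ≠ q) : polar Q p q = 1 := by
  obtain ⟨v, w, hvw, hv, hw, h, hl⟩ := hl
  have h' : polar Q w v = 1 := by rw [polar_comm, h]
  rw [hl] at hp hq
  rcases hp with rfl | rfl | rfl <;> rcases hq with rfl | rfl | rfl <;>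
    simp_all [-QuadraticMap.polar_self, polar_add_left, polar_add_right, polar_self_zero]

theorem exists_line {v w : V} (hv : Q v = 1) (hw : Q w = 1) (h : polar Q v w = 1) :
    ∃ l ∈ (cotri Q).lines, Subtype.val '' l = {v, w, v + w} := by
  have hvw : v ≠ w := by
    rintro rfl
    rw [polar_self_zero] at h
    exact absurd h (by decide)
  have h1 : Subtype.val '' (Subtype.val ⁻¹' {v, w, v + w} : Set {v : V // IsPoint Q v}) =
      {v, w, v + w} := by
    refine Set.image_preimage_eq_of_subset ?_
    rintro x (rfl | rfl | rfl)
    · exact ⟨⟨_, isPoint_of_polar hv h⟩, rfl⟩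
    · exact ⟨⟨_, isPoint_of_polar (w := v) hw (by rw [polar_comm, h])⟩, rfl⟩
    · exact ⟨⟨_, isPoint_add hv hw h⟩, rfl⟩
  exact ⟨_, ⟨v, w, hvw, hv, hw, h, h1⟩, h1⟩

theorem mem_nbrs_cotri {p q : {v : V // IsPoint Q v}} :
    q ∈ (cotri Q).nbrs p ↔ polar Q p.1 q.1 = 1 := by
  constructor
  · rintro ⟨hqp, l, hl, hp, hq⟩
    exact polar_of_mem_line hl ⟨p, hp, rfl⟩ ⟨q, hq, rfl⟩ (fun h => hqp (Subtype.ext h.symm))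
  · intro h
    obtain ⟨l, hl, hl'⟩ := exists_line p.2.1 q.2.1 h
    refine ⟨?_, l, hl, ?_, ?_⟩
    · rintro rfl
      rw [polar_self_zero] at h
      exact absurd h (by decide)
    · exact (Subtype.val_injective.mem_set_image).1 (by rw [hl']; simp)
    · exact (Subtype.val_injective.mem_set_image).1 (by rw [hl']; simp)

theorem Gen.isPoint {X : Set V} (hX : ∀ x ∈ X, IsPoint Q x) {v : V} (h : Gen Q X v) :
    IsPoint Q v := by
  induction h with
  | base h => exact hX _ h
  | add _ _ h h1 h2 => exact isPoint_add h1.1 h2.1 h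

end Cotriangular

/-! ### The reduced graph as the graph of twin classes. -/

section Reduced

variable {V : Type u} [LinearOrder V] (Γ : SimpleGraph V)

theorem mem_vertexNbrs {x : V} {p : {v // IsPoint (graphQuad Γ) v}} :
    p ∈ vertexNbrs Γ x ↔ polar (graphQuad Γ) (Finsupp.single x 1) p.1 = 1 := by
  constructor
  · rintro ⟨hpx, l, hl, hp, hx⟩
    exact polar_of_mem_line hl hx ⟨p, hp, rfl⟩ hpx.symm
  · intro h
    obtain ⟨l, hl, hl'⟩ := exists_line (graphQuad_single Γ x) p.2.1 h
    refine ⟨?_, l, hl, ?_, ?_⟩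
    · intro h'
      rw [h', polar_self_zero] at h
      exact absurd h (by decide)
    · exact (Subtype.val_injective.mem_set_image).1 (by rw [hl']; simp)
    · rw [hl']; simp

theorem span_range_single {I : Type*} :
    Submodule.span (ZMod 2) (Set.range fun x : I => (Finsupp.single x 1 : I →₀ ZMod 2)) = ⊤ := by
  rw [eq_top_iff]
  intro v _
  induction v using Finsupp.induction_linear with
  | zero => exact zero_mem _
  | add v w hv hw => exact add_mem (hv trivial) (hw trivial)
  | single x a =>
    have h1 := Submodule.smul_mem (R := ZMod 2) _ a (Submodule.subset_span (R := ZMod 2)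
      (s := Set.range fun x : I => (Finsupp.single x 1 : I →₀ ZMod 2)) ⟨x, rfl⟩)
    simpa using h1

theorem polar_eq_of_single {I : Type*} {Q : QuadraticForm (ZMod 2) (I →₀ ZMod 2)}
    {v w : I →₀ ZMod 2}
    (h : ∀ x, polar Q v (Finsupp.single x 1) = 1 ↔ polar Q w (Finsupp.single x 1) = 1)
    (z : I →₀ ZMod 2) : polar Q v z = polar Q w z := by
  have h1 : polar Q (v + w) z = 0 := by
    refine polar_eq_zero_of_mem_span (X := Set.range fun x => Finsupp.single x 1) ?_
      (by rw [span_range_single]; trivial)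
    rintro _ ⟨x, rfl⟩
    have := h x
    rw [polar_add_left]
    rcases zmod2_cases (polar Q v (Finsupp.single x 1)) with h1 | h1 <;>
      rcases zmod2_cases (polar Q w (Finsupp.single x 1)) with h2 | h2 <;>
      rw [h1, h2] at this ⊢ <;> revert this <;> decide
  rw [polar_add_left] at h1
  grind

/-- Equivalent vertices are twins: a neighbour of a vertex is a point, and products with vertices
determine products with all vectors. -/
theorem equivVertices_iff {x y : V} :
    equivVertices Γ x y ↔ ∀ z, Γ.Adj x z ↔ Γ.Adj y z := by
  change vertexNbrs Γ x = vertexNbrs Γ y ↔ _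
  simp only [Set.ext_iff, mem_vertexNbrs]
  constructor
  · intro h z
    rw [← polar_graphQuad_eq_one, ← polar_graphQuad_eq_one]
    constructor <;> intro hz
    · exact (h ⟨_, isPoint_of_polar (graphQuad_single Γ z) (by rw [polar_comm, hz])⟩).1 hz
    · exact (h ⟨_, isPoint_of_polar (graphQuad_single Γ z) (by rw [polar_comm, hz])⟩).2 hz
  · intro h p
    rw [polar_eq_of_single (v := Finsupp.single x 1) (w := Finsupp.single y 1)]
    intro z
    rw [polar_graphQuad_eq_one, polar_graphQuad_eq_one, h]

theorem reducedGraph_adj {x y : V} :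
    (reducedGraph Γ).Adj (Quotient.mk _ x) (Quotient.mk _ y) ↔ Γ.Adj x y := by
  constructor
  · rintro ⟨-, x', y', hx, hy, h⟩
    rw [← (equivVertices_iff Γ).1 (Quotient.exact hx), Γ.adj_comm,
      ← (equivVertices_iff Γ).1 (Quotient.exact hy), Γ.adj_comm]
    exact h
  · intro h
    refine ⟨fun h' => ?_, x, y, rfl, rfl, h⟩
    exact Γ.irrefl (((equivVertices_iff Γ).1 (Quotient.exact h') y).1 h)

theorem reducedGraph_preconnected (hΓ : Γ.Preconnected) : (reducedGraph Γ).Preconnected := by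
  intro a b
  induction a using Quotient.inductionOn with | _ x
  induction b using Quotient.inductionOn with | _ y
  exact (hΓ x y).map
    (⟨Quotient.mk (equivVertices Γ), fun h => (reducedGraph_adj Γ).2 h⟩ : Γ →g reducedGraph Γ)

theorem reducedGraph_twin {a b : ReducedVertex Γ}
    (h : ∀ c, (reducedGraph Γ).Adj a c ↔ (reducedGraph Γ).Adj b c) : a = b := by
  induction a using Quotient.inductionOn with | _ x
  induction b using Quotient.inductionOn with | _ y
  refine Quotient.sound ((equivVertices_iff Γ).2 fun z => ?_)
  rw [← reducedGraph_adj Γ, ← reducedGraph_adj Γ]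
  exact h (Quotient.mk _ z)

theorem isPoint_single {x y : V} (h : Γ.Adj x y) :
    IsPoint (graphQuad Γ) (Finsupp.single x 1) :=
  isPoint_of_polar (graphQuad_single Γ x) ((polar_graphQuad_eq_one Γ x y).2 h)

theorem exists_adj_of_preconnected {ι : Type*} {G : SimpleGraph ι} (hG : G.Preconnected)
    {x y : ι} (hxy : x ≠ y) : ∃ z, G.Adj x z := by
  obtain ⟨p⟩ := hG x y
  cases p with
  | nil => exact absurd rfl hxy
  | cons h p => exact ⟨_, h⟩

variable (F : Type w) [Field F]

/-- If the reduced graph is not a line graph, then `𝔎(Γ)` maps onto the span of the points of the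
cotriangular space of the reduced graph. -/
theorem exists_quotient_equiv_pointLie (hF : (2 : F) ≠ 0) (hΓ : Γ.Preconnected)
    [LinearOrder (ReducedVertex Γ)] (hline : ¬ IsLineGraph (reducedGraph Γ)) :
    ∃ J : LieIdeal F (vertexGenerated Γ Set.univ F),
      Nonempty ((vertexGenerated Γ Set.univ F ⧸ J) ≃ₗ⁅F⁆
        pointLie F (graphForm (reducedGraph Γ) Set.univ)) := by
  have hG := reducedGraph_preconnected Γ hΓ
  refine exists_quotient_equiv_spanLie F Γ hF (graphForm (reducedGraph Γ) Set.univ)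
    (fun x => Finsupp.single (Quotient.mk _ x) 1) (fun x => graphQuad_single _ _)
    (fun x y => by rw [polar_graphQuad_eq_one, reducedGraph_adj]) _ _ ?_
  have hrange : (Set.range fun x => (Finsupp.single (Quotient.mk (equivVertices Γ) x) 1 :
      ReducedVertex Γ →₀ ZMod 2)) = Set.range fun a => Finsupp.single a 1 :=
    (Quotient.mk_surjective).range_comp fun a => (Finsupp.single a 1 : ReducedVertex Γ →₀ ZMod 2)
  rw [hrange]
  refine fun v => ⟨fun hv => ?_, fun hv => ?_⟩
  · exact gen_of_isPoint_of_not_isLineGraph (reducedGraph Γ) hG (fun a => Finsupp.single a 1)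
      span_range_single (graphQuad_single _) (fun a b => (polar_graphQuad_eq_one _ a b).symm)
      (fun a b => reducedGraph_twin Γ) hline hv
  · refine hv.isPoint ?_
    rintro _ ⟨a, rfl⟩
    -- A graph with a single vertex is a line graph; so here every vertex has a neighbour and is a
    -- point.
    obtain ⟨b, hb⟩ : ∃ b, a ≠ b := by
      by_contra! h
      exact hline (isLineGraph_of_complete _ fun i j hij => absurd ((h i).symm.trans (h j)) hij)
    obtain ⟨c, hc⟩ := exists_adj_of_preconnected hG hb
    exact isPoint_single _ hc

theorem nonisotropicLie_eq_pointLie {V : Type*} [AddCommGroup V] [Module (ZMod 2) V]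
    (g : LinearMap.BilinForm (ZMod 2) V)
    (h : ∀ v, quad g v = 1 → ∃ w, polar (quad g) v w ≠ 0) :
    nonisotropicLie F g = pointLie F g := by
  have h1 : {v | quad g v = 1} = {v | IsPoint (quad g) v} :=
    Set.ext fun v => ⟨fun hv => ⟨hv, h v hv⟩, fun hv => hv.1⟩
  unfold nonisotropicLie pointLie spanLie
  simp only [h1]

end Reduced

/-! ## The reduction of the cotriangular space of a graph -/

section Reduction

theorem mem_lines_cotri {V : Type*} [AddCommGroup V] [Module (ZMod 2) V]
    {Q : QuadraticForm (ZMod 2) V} {l : Set {v : V // IsPoint Q v}} :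
    l ∈ (cotri Q).lines ↔ ∃ p q r : {v : V // IsPoint Q v},
      polar Q p.1 q.1 = 1 ∧ r.1 = p.1 + q.1 ∧ l = {p, q, r} := by
  constructor
  · rintro ⟨v, w, -, -, -, h, hl⟩
    obtain ⟨p, -, hp⟩ : v ∈ Subtype.val '' l := by rw [hl]; simp
    obtain ⟨q, -, hq⟩ : w ∈ Subtype.val '' l := by rw [hl]; simp
    obtain ⟨r, -, hr⟩ : v + w ∈ Subtype.val '' l := by rw [hl]; simp
    refine ⟨p, q, r, by rw [hp, hq, h], by rw [hp, hq, hr], ?_⟩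
    apply Set.image_injective.2 Subtype.val_injective
    rw [hl, Set.image_insert_eq, Set.image_pair, hp, hq, hr]
  · rintro ⟨p, q, r, h, hr, rfl⟩
    refine ⟨p, q, ?_, p.2.1, q.2.1, h, ?_⟩
    · intro hpq
      rw [hpq, polar_self_zero] at h
      exact absurd h (by decide)
    · rw [Set.image_insert_eq, Set.image_pair, hr]

variable {V : Type u} [LinearOrder V] (Γ : SimpleGraph V)

/-- The closure of the vertices. -/
abbrev VertexGen (v : V →₀ ZMod 2) : Prop :=
  Gen (graphQuad Γ) (Set.range fun x => Finsupp.single x 1) v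

variable {Γ}

theorem VertexGen.isPoint (hΓ : ∀ x, ∃ y, Γ.Adj x y) {v : V →₀ ZMod 2} (hv : VertexGen Γ v) :
    IsPoint (graphQuad Γ) v := by
  refine Gen.isPoint ?_ hv
  rintro _ ⟨x, rfl⟩
  obtain ⟨y, h⟩ := hΓ x
  exact isPoint_single Γ h

/-- The class of a point in the reduction. -/
abbrev pointClass (p : {v // IsPoint (graphQuad Γ) v}) :
    Quotient (cotri (graphQuad Γ)).equivPoints := Quotient.mk _ p

/-- All vertices are points and they span the space, so the collinear points determine the
functional `f(p, ·)`. -/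
theorem pointClass_eq_iff (hΓ : ∀ x, ∃ y, Γ.Adj x y) {p q : {v // IsPoint (graphQuad Γ) v}} :
    pointClass p = pointClass q ↔
      ∀ z, polar (graphQuad Γ) p.1 z = polar (graphQuad Γ) q.1 z := by
  rw [Quotient.eq]
  change (cotri (graphQuad Γ)).nbrs p = (cotri (graphQuad Γ)).nbrs q ↔ _
  simp only [Set.ext_iff, mem_nbrs_cotri]
  constructor
  · refine fun h => polar_eq_of_single fun x => ?_
    obtain ⟨y, hy⟩ := hΓ x
    exact h ⟨_, isPoint_single Γ hy⟩
  · intro h z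
    rw [h]

/-- The classes of the closure form a subspace: if `p`, `q` on a line are equivalent to `p'`, `q'`
in the closure, then `p + q` is equivalent to `p' + q'`. -/
theorem mem_gen_vertexClasses (hΓ : ∀ x, ∃ y, Γ.Adj x y)
    {c : Quotient (cotri (graphQuad Γ)).equivPoints} :
    c ∈ (cotri (graphQuad Γ)).reduction.gen (vertexClasses Γ) ↔
      ∃ p : {v // IsPoint (graphQuad Γ) v}, VertexGen Γ p.1 ∧ c = pointClass p := by
  constructor
  · intro hc
    refine hc {c | ∃ p : {v // IsPoint (graphQuad Γ) v}, VertexGen Γ p.1 ∧ c = pointClass p}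
      ⟨?_, ?_⟩
    · rintro _ ⟨l, hl, rfl⟩ ⟨c, ⟨p, hp, rfl⟩, c', ⟨q, hq, rfl⟩, hne, ⟨p', hp', hpp'⟩, q', hq', hqq'⟩
      have hpq : polar (graphQuad Γ) p.1 q.1 = 1 := by
        refine polar_of_mem_line hl ⟨p, hp, rfl⟩ ⟨q, hq, rfl⟩ fun h => ?_
        rw [Subtype.ext h] at hne
        exact hne rfl
      have hpp := (pointClass_eq_iff hΓ).1 hpp'
      have hqq := (pointClass_eq_iff hΓ).1 hqq'
      have hpq' : polar (graphQuad Γ) p'.1 q'.1 = 1 := by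
        rw [← hpp, polar_comm, ← hqq, polar_comm, hpq]
      have hsum : ∀ r ∈ l, r.1 = p.1 + q.1 → ∃ p : {v // IsPoint (graphQuad Γ) v},
          VertexGen Γ p.1 ∧ pointClass r = pointClass p := by
        intro r _ hr
        refine ⟨⟨p'.1 + q'.1, isPoint_add p'.2.1 q'.2.1 hpq'⟩, hp'.add hq' hpq', ?_⟩
        rw [pointClass_eq_iff hΓ]
        intro z
        rw [hr, polar_add_left, polar_add_left, hpp, hqq]
      rintro _ ⟨r, hr, rfl⟩
      by_cases hrp : r = p
      · rw [hrp]; exact ⟨p', hp', hpp'⟩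
      by_cases hrq : r = q
      · rw [hrq]; exact ⟨q', hq', hqq'⟩
      refine hsum r hr ?_
      obtain ⟨x, y, z, hxy, hz, rfl⟩ := mem_lines_cotri.1 hl
      have h0 := ZModModule.add_self x.1
      have h1 := ZModModule.add_self y.1
      rcases hp with rfl | rfl | rfl <;> rcases hq with rfl | rfl | rfl <;>
        rcases hr with rfl | rfl | rfl <;>
        first
          | exact absurd rfl hrp
          | exact absurd rfl hrq
          | exact absurd rfl hne
          | exact hz
          | (rw [hz]; grind)
    · rintro _ ⟨x, hx, rfl⟩
      exact ⟨_, .base ⟨x, rfl⟩, rfl⟩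
  · rintro ⟨⟨v, hv⟩, hg, rfl⟩ Y ⟨hY, hYX⟩
    change VertexGen Γ v at hg
    induction hg with
    | base h =>
      obtain ⟨x, rfl⟩ := h
      exact hYX ⟨x, hv, rfl⟩
    | @add v w h1 h2 h ih1 ih2 =>
      have hv1 := VertexGen.isPoint hΓ h1
      have hw1 := VertexGen.isPoint hΓ h2
      let p : {v // IsPoint (graphQuad Γ) v} := ⟨v, hv1⟩
      let q : {v // IsPoint (graphQuad Γ) v} := ⟨w, hw1⟩
      let r : {v // IsPoint (graphQuad Γ) v} := ⟨v + w, hv⟩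
      have hl : {p, q, r} ∈ (cotri (graphQuad Γ)).lines := mem_lines_cotri.2 ⟨p, q, r, h, rfl, rfl⟩
      refine hY (pointClass '' {p, q, r}) ⟨_, hl, rfl⟩ ⟨pointClass p, ⟨p, .inl rfl, rfl⟩,
        pointClass q, ⟨q, .inr (.inl rfl), rfl⟩, ?_, ih1 hv1, ih2 hw1⟩ ⟨r, .inr (.inr rfl), rfl⟩
      intro h3
      have h4 := (pointClass_eq_iff hΓ).1 h3 w
      rw [polar_self_zero, h] at h4
      exact absurd h4 (by decide)

end Reduction

/-! ## The space `𝒯(Ω)` in terms of vectors of weight two -/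

section Triangular

variable {Ω : Type u}

/-- The vector of a finite set. -/
def setVec (s : Finset Ω) : Ω →₀ ZMod 2 := ∑ o ∈ s, Finsupp.single o 1

theorem setVec_pair [DecidableEq Ω] {a b : Ω} (h : a ≠ b) :
    setVec {a, b} = Finsupp.single a 1 + Finsupp.single b 1 := Finset.sum_pair h

theorem setVec_apply (s : Finset Ω) [DecidableEq Ω] (o : Ω) :
    setVec s o = if o ∈ s then 1 else 0 := by
  simp [setVec, Finsupp.single_apply]

theorem setVec_injective : Function.Injective (setVec (Ω := Ω)) := by
  classical
  intro s t h
  ext o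
  have h1 := DFunLike.congr_fun h o
  rw [setVec_apply, setVec_apply] at h1
  split_ifs at h1 with h2 h3 h3 <;> simp_all

theorem mem_weightTwo_iff {v : Ω →₀ ZMod 2} :
    v ∈ weightTwo Ω ↔ ∃ s : {s : Finset Ω // s.card = 2}, setVec s.1 = v := by
  classical
  constructor
  · rintro ⟨a, b, hab, rfl⟩
    exact ⟨⟨{a, b}, Finset.card_pair hab⟩, setVec_pair hab⟩
  · rintro ⟨⟨s, hs⟩, rfl⟩
    obtain ⟨a, b, hab, rfl⟩ := Finset.card_eq_two.1 hs
    exact ⟨a, b, hab, setVec_pair hab⟩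

theorem pair_subset_triple [DecidableEq Ω] {x y z : Ω} (hxy : x ≠ y) (hyz : y ≠ z) (hxz : x ≠ z)
    {s : Finset Ω} (hs : s.card = 2) :
    s ⊆ {x, y, z} ↔ s = {x, y} ∨ s = {y, z} ∨ s = {x, z} := by
  constructor
  · intro h
    obtain ⟨p, q, hpq, rfl⟩ := Finset.card_eq_two.1 hs
    have hp : p ∈ ({x, y, z} : Finset Ω) := h (by simp)
    have hq : q ∈ ({x, y, z} : Finset Ω) := h (by simp)
    simp only [Finset.mem_insert, Finset.mem_singleton] at hp hq
    rcases hp with rfl | rfl | rfl <;> rcases hq with rfl | rfl | rfl <;>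
      simp_all [Finset.pair_comm]
  · rintro (rfl | rfl | rfl) <;> intro o <;> simp <;> tauto

variable [LinearOrder Ω]

theorem polar_omega_pair {a b c d : Ω} (hab : a ≠ b) (hcd : c ≠ d) :
    polar (quad (omegaForm Ω)) (Finsupp.single a 1 + Finsupp.single b 1)
      (Finsupp.single c 1 + Finsupp.single d 1) = 1 ↔
      s(a, b) ≠ s(c, d) ∧ ∃ o, o ∈ s(a, b) ∧ o ∈ s(c, d) := by
  classical
  rw [← pair_parity hab hcd]
  -- Written in this way, the constant terms occur four times and cancel, leaving the parity of the
  -- intersection.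
  have h1 (a b : Ω) : polar (quad (omegaForm Ω)) (Finsupp.single a 1) (Finsupp.single b 1) =
      1 + if a = b then 1 else 0 := by
    rw [polar_omega]
    split_ifs <;> decide
  simp only [polar_add_left, polar_add_right, h1]
  refine Eq.congr ?_ rfl
  grind

theorem mem_lines_triangular {m : Set {s : Finset Ω // s.card = 2}} :
    m ∈ (triangular Ω).lines ↔ ∃ p q r : {s : Finset Ω // s.card = 2},
      polar (quad (omegaForm Ω)) (setVec p.1) (setVec q.1) = 1 ∧
        setVec r.1 = setVec p.1 + setVec q.1 ∧ m = {p, q, r} := by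
  have hline {x y z : Ω} (hxy : x ≠ y) (hyz : y ≠ z) (hxz : x ≠ z) :
      {s : {s : Finset Ω // s.card = 2} | s.1 ⊆ {x, y, z}} = {⟨{x, y}, Finset.card_pair hxy⟩,
        ⟨{y, z}, Finset.card_pair hyz⟩, ⟨{x, z}, Finset.card_pair hxz⟩} := by
    ext ⟨s, hs⟩
    simpa using pair_subset_triple hxy hyz hxz hs
  have hsum {x y z : Ω} (hxy : x ≠ y) (hyz : y ≠ z) (hxz : x ≠ z) :
      setVec {x, z} = setVec {x, y} + setVec {y, z} := by
    rw [setVec_pair hxy, setVec_pair hyz, setVec_pair hxz, ← add_assoc, add_add_self]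
  constructor
  · rintro ⟨t, ht, rfl⟩
    obtain ⟨x, y, z, hxy, hxz, hyz, rfl⟩ := Finset.card_eq_three.1 ht
    refine ⟨_, _, _, ?_, ?_, hline hxy hyz hxz⟩
    · change polar _ (setVec {x, y}) (setVec {y, z}) = 1
      rw [setVec_pair hxy, setVec_pair hyz, polar_omega_pair hxy hyz]
      refine ⟨?_, y, by simp, by simp⟩
      rw [ne_eq, Sym2.eq_iff]
      tauto
    · exact hsum hxy hyz hxz
  · rintro ⟨⟨s, hs⟩, ⟨t, ht⟩, ⟨r, hr⟩, hpol, hadd, rfl⟩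
    obtain ⟨x, y, z, hxy, hyz, hxz, rfl, rfl⟩ : ∃ x y z : Ω, x ≠ y ∧ y ≠ z ∧ x ≠ z ∧
        s = {x, y} ∧ t = {y, z} := by
      obtain ⟨a, b, hab, rfl⟩ := Finset.card_eq_two.1 hs
      obtain ⟨c, d, hcd, rfl⟩ := Finset.card_eq_two.1 ht
      dsimp only at hpol
      rw [setVec_pair hab, setVec_pair hcd, polar_omega_pair hab hcd, ne_eq, Sym2.eq_iff] at hpol
      obtain ⟨hne, o, ho, ho'⟩ := hpol
      rw [Sym2.mem_iff] at ho ho'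
      rcases ho with rfl | rfl <;> rcases ho' with rfl | rfl
      · exact ⟨b, o, d, hab.symm, hcd, by tauto, Finset.pair_comm _ _, rfl⟩
      · exact ⟨b, o, c, hab.symm, hcd.symm, by tauto, Finset.pair_comm _ _, Finset.pair_comm _ _⟩
      · exact ⟨a, o, d, hab, hcd, by tauto, rfl, rfl⟩
      · exact ⟨a, o, c, hab, hcd.symm, by tauto, rfl, Finset.pair_comm _ _⟩
    obtain rfl : r = {x, z} := setVec_injective (by rw [hsum hxy hyz hxz]; exact hadd)
    refine ⟨{x, y, z}, ?_, (hline hxy hyz hxz).symm⟩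
    exact Finset.card_eq_three.2 ⟨x, y, z, hxy, hxz, hyz, rfl⟩

/-- Unless `|Ω| = 4`, vectors of weight two are determined by their products with all vectors of
weight two. -/
theorem weightTwo_ext (h4 : ∀ t : Finset Ω, t.card = 4 → ∃ o, o ∉ t) {v w : Ω →₀ ZMod 2}
    (hv : v ∈ weightTwo Ω) (hw : w ∈ weightTwo Ω)
    (h : ∀ z ∈ weightTwo Ω, polar (quad (omegaForm Ω)) v z = polar (quad (omegaForm Ω)) w z) :
    v = w := by
  have hv' := hv
  obtain ⟨a, b, hab, rfl⟩ := hv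
  obtain ⟨c, d, hcd, rfl⟩ := hw
  by_contra hne
  have hne' : s(a, b) ≠ s(c, d) := by
    intro h1
    rcases Sym2.eq_iff.1 h1 with ⟨rfl, rfl⟩ | ⟨rfl, rfl⟩
    · exact hne rfl
    · exact hne (add_comm _ _)
  by_cases ho : ∃ o, o ∈ s(a, b) ∧ o ∈ s(c, d)
  · have h1 := h _ hv'
    rw [polar_self_zero, polar_comm, (polar_omega_pair hab hcd).2 ⟨hne', ho⟩] at h1
    exact absurd h1 (by decide)
  · have hdis : a ≠ c ∧ a ≠ d ∧ b ≠ c ∧ b ≠ d := by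
      have hoo (o : Ω) (h1 : o = a ∨ o = b) (h2 : o = c ∨ o = d) : False :=
        ho ⟨o, Sym2.mem_iff.2 h1, Sym2.mem_iff.2 h2⟩
      exact ⟨fun h => hoo a (.inl rfl) (.inl h), fun h => hoo a (.inl rfl) (.inr h),
        fun h => hoo b (.inr rfl) (.inl h), fun h => hoo b (.inr rfl) (.inr h)⟩
    -- For disjoint pairs a fifth element `o` is needed: the pair `{a, o}` meets `{a, b}` but not
    -- `{c, d}`.
    obtain ⟨o, ho'⟩ := h4 {a, b, c, d} (by
      simp [Finset.card_insert_of_notMem, hab, hcd, hdis])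
    simp only [Finset.mem_insert, Finset.mem_singleton, not_or] at ho'
    obtain ⟨hoa, hob, hoc, hod⟩ := ho'
    have h1 := h _ ⟨a, o, Ne.symm hoa, rfl⟩
    rw [(polar_omega_pair hab (Ne.symm hoa)).2 ⟨by
      rw [ne_eq, Sym2.eq_iff]; tauto, a, by simp, by simp⟩] at h1
    obtain ⟨-, x, hx, hx'⟩ := (polar_omega_pair hcd (Ne.symm hoa)).1 h1.symm
    rw [Sym2.mem_iff] at hx hx'
    rcases hx with rfl | rfl <;> rcases hx' with rfl | rfl <;> tauto

end Triangular

/-! ## Graphs whose vertices are pairs -/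

section Pairs

variable {V Ω : Type u} {Γ : SimpleGraph V} {a d : V → Ω}

/-- Consecutive pairs on a walk share an element `c`, so `{o, o'}` is obtained from `{o, c}` and, by
induction, `{c, o'}`. -/
theorem gen_pair_of_reachable [LinearOrder Ω]
    (hadj : ∀ x y, Γ.Adj x y ↔
      s(a x, d x) ≠ s(a y, d y) ∧ ∃ o, o ∈ s(a x, d x) ∧ o ∈ s(a y, d y))
    {x y : V} (hxy : Γ.Reachable x y) {o o' : Ω} (ho : o ∈ s(a x, d x)) (ho' : o' ∈ s(a y, d y))
    (hne : o ≠ o') : Gen (quad (omegaForm Ω))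
      (Set.range fun x => Finsupp.single (a x) 1 + Finsupp.single (d x) 1)
      (Finsupp.single o 1 + Finsupp.single o' 1) := by
  have hbase (x : V) {o o' : Ω} (ho : o ∈ s(a x, d x)) (ho' : o' ∈ s(a x, d x)) (hne : o ≠ o') :
      Gen (quad (omegaForm Ω))
        (Set.range fun x => Finsupp.single (a x) 1 + Finsupp.single (d x) 1)
        (Finsupp.single o 1 + Finsupp.single o' 1) := by
    rw [Sym2.mem_iff] at ho ho'
    rcases ho with rfl | rfl <;> rcases ho' with rfl | rfl
    · exact absurd rfl hne
    · exact .base ⟨x, rfl⟩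
    · exact .base ⟨x, add_comm _ _⟩
    · exact absurd rfl hne
  obtain ⟨p⟩ := hxy
  induction p generalizing o with
  | nil => exact hbase _ ho ho' hne
  | @cons x z y hxz p ih =>
    obtain ⟨-, c, hc, hc'⟩ := (hadj x z).1 hxz
    by_cases hoc : o = c
    · subst hoc
      exact ih hc' ho' hne
    · have h1 := hbase x ho hc hoc
      by_cases hco : c = o'
      · rwa [← hco]
      · have h2 := h1.add (ih hc' ho' hco) ((polar_omega_pair hoc hco).2 ⟨by
          rw [ne_eq, Sym2.eq_iff]; tauto, c, by simp, by simp⟩)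
        rwa [← add_assoc, add_add_self] at h2

theorem mem_weightTwo_iff_gen [LinearOrder Ω] (had : ∀ x, a x ≠ d x)
    (hadj : ∀ x y, Γ.Adj x y ↔
      s(a x, d x) ≠ s(a y, d y) ∧ ∃ o, o ∈ s(a x, d x) ∧ o ∈ s(a y, d y))
    (hcov : ∀ o, ∃ x, o ∈ s(a x, d x)) (hΓ : Γ.Preconnected) (v : Ω →₀ ZMod 2) :
    v ∈ weightTwo Ω ↔ Gen (quad (omegaForm Ω))
      (Set.range fun x => Finsupp.single (a x) 1 + Finsupp.single (d x) 1) v := by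
  constructor
  · rintro ⟨o, o', hne, rfl⟩
    obtain ⟨x, hx⟩ := hcov o
    obtain ⟨y, hy⟩ := hcov o'
    exact gen_pair_of_reachable hadj (hΓ x y) hx hy hne
  · intro h
    induction h with
    | base h =>
      obtain ⟨x, rfl⟩ := h
      exact ⟨_, _, had x, rfl⟩
    | add _ _ h h1 h2 => exact weightTwo_add Ω _ h1 _ h2 h

variable [LinearOrder V] (F : Type w) [Field F]

theorem exists_quotient_equiv_omegaLie (hF : (2 : F) ≠ 0) [LinearOrder Ω]
    (had : ∀ x, a x ≠ d x) (hadj : ∀ x y, Γ.Adj x y ↔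
      s(a x, d x) ≠ s(a y, d y) ∧ ∃ o, o ∈ s(a x, d x) ∧ o ∈ s(a y, d y))
    (hcov : ∀ o, ∃ x, o ∈ s(a x, d x)) (hΓ : Γ.Preconnected) :
    ∃ J : LieIdeal F (vertexGenerated Γ Set.univ F),
      Nonempty ((vertexGenerated Γ Set.univ F ⧸ J) ≃ₗ⁅F⁆ omegaLie F Ω) :=
  exists_quotient_equiv_spanLie F Γ hF (omegaForm Ω)
    (fun x => Finsupp.single (a x) 1 + Finsupp.single (d x) 1) (fun x => omega_pair Ω (had x))
    (fun x y => by rw [hadj, polar_omega_pair (had x) (had y)]) _ _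
    (mem_weightTwo_iff_gen had hadj hcov hΓ)

/-- An isomorphism of point-line spaces from a bijection in the other direction. -/
def PointLine.Iso.ofEquivSymm {P P' : Type*} {S : PointLine P} {S' : PointLine P'} (ψ : P' ≃ P)
    (h : ∀ m, m ∈ S'.lines ↔ ψ '' m ∈ S.lines) : S.Iso S' where
  toEquiv := ψ.symm
  map_lines l := by
    rw [h, Equiv.image_symm_eq_preimage, Equiv.image_preimage]

/-- The map `π` preserves `Q` and carries the closure of the vertices onto the vectors of weight
two. Two points of the closure are equivalent if and only if they have the same image, so the points
of the reduced space are the pairs, and both kinds of lines are given by sums. -/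
theorem nonempty_iso_triangular (had : ∀ x, a x ≠ d x) (hadj : ∀ x y, Γ.Adj x y ↔
      s(a x, d x) ≠ s(a y, d y) ∧ ∃ o, o ∈ s(a x, d x) ∧ o ∈ s(a y, d y))
    (hcov : ∀ o, ∃ x, o ∈ s(a x, d x)) (hΓ : Γ.Preconnected) (hnb : ∀ x, ∃ y, Γ.Adj x y)
    (h4 : ∀ t : Finset Ω, t.card = 4 → ∃ o, o ∉ t) :
    Nonempty ((reducedSpace Γ).Iso (triangular Ω)) := by
  classical
  -- The order only serves to write down a bilinear form on `𝔽₂Ω`; the conclusion does not involve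
  -- it.
  let _ : LinearOrder Ω := IsWellOrder.linearOrder WellOrderingRel
  set π := Finsupp.linearCombination (ZMod 2)
    (fun x => (Finsupp.single (a x) 1 + Finsupp.single (d x) 1 : Ω →₀ ZMod 2)) with hπdef
  have hπ (v : V →₀ ZMod 2) : quad (omegaForm Ω) (π v) = graphQuad Γ v :=
    quad_graphMap Γ (fun x => omega_pair Ω (had x))
      (fun x y => by rw [hadj, polar_omega_pair (had x) (had y)]) v
  have hpol := polar_of_quad_eq π hπ
  have hrange : (Set.range fun x => (Finsupp.single (a x) 1 + Finsupp.single (d x) 1 :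
      Ω →₀ ZMod 2)) = π '' Set.range fun x => Finsupp.single x 1 := by
    rw [← Set.range_comp]
    congr 1
    funext x
    simp [hπdef]
  have hW (v : Ω →₀ ZMod 2) : v ∈ weightTwo Ω ↔
      Gen (quad (omegaForm Ω)) (π '' Set.range fun x => Finsupp.single x 1) v := by
    rw [← hrange]
    exact mem_weightTwo_iff_gen had hadj hcov hΓ v
  have hlift (s : {s : Finset Ω // s.card = 2}) : ∃ p : {v // IsPoint (graphQuad Γ) v},
      VertexGen Γ p.1 ∧ π p.1 = setVec s.1 := by
    obtain ⟨v, hv, hvs⟩ := Gen.exists_lift π hπ ((hW _).1 (mem_weightTwo_iff.2 ⟨s, rfl⟩))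
    exact ⟨⟨v, VertexGen.isPoint hnb hv⟩, hv, hvs⟩
  have hmem {v : V →₀ ZMod 2} (hv : VertexGen Γ v) : π v ∈ weightTwo Ω := by
    rw [hW]
    exact Gen.map π hπ (fun x hx => .base (Set.mem_image_of_mem π hx)) hv
  -- Equivalence gives equal products with all vectors of weight two; it is here that `|Ω| = 4` must
  -- be excluded.
  have hclass {p q : {v // IsPoint (graphQuad Γ) v}} (hp : VertexGen Γ p.1)
      (hq : VertexGen Γ q.1) : pointClass p = pointClass q ↔ π p.1 = π q.1 := by
    rw [pointClass_eq_iff hnb]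
    constructor
    · intro h
      refine weightTwo_ext h4 (hmem hp) (hmem hq) fun z hz => ?_
      obtain ⟨v, hv, rfl⟩ := Gen.exists_lift π hπ ((hW z).1 hz)
      rw [hpol, hpol, h]
    · intro h z
      rw [← hpol, h, hpol]
  choose lift hliftg hliftπ using hlift
  let ψ : {s : Finset Ω // s.card = 2} →
      (cotri (graphQuad Γ)).reduction.gen (vertexClasses Γ) :=
    fun s => ⟨pointClass (lift s), (mem_gen_vertexClasses hnb).2 ⟨lift s, hliftg s, rfl⟩⟩
  have hψinj : Function.Injective ψ := by
    intro s t h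
    have h1 := (hclass (hliftg s) (hliftg t)).1 (congrArg Subtype.val h)
    rw [hliftπ, hliftπ] at h1
    exact Subtype.ext (setVec_injective h1)
  have hψsurj : Function.Surjective ψ := by
    rintro ⟨c, hc⟩
    obtain ⟨p, hp, rfl⟩ := (mem_gen_vertexClasses hnb).1 hc
    obtain ⟨s, hs⟩ := mem_weightTwo_iff.1 (hmem hp)
    exact ⟨s, Subtype.ext ((hclass (hliftg s) hp).2 (by rw [hliftπ, hs]))⟩
  refine ⟨PointLine.Iso.ofEquivSymm (Equiv.ofBijective ψ ⟨hψinj, hψsurj⟩) fun m => ?_⟩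
  change m ∈ (triangular Ω).lines ↔
    ∃ l ∈ (cotri (graphQuad Γ)).lines, Subtype.val '' (ψ '' m) = pointClass '' l
  rw [mem_lines_triangular]
  constructor
  · rintro ⟨s, t, r, hst, hr, rfl⟩
    rw [← hliftπ, ← hliftπ, hpol] at hst
    have hadd := (hliftg s).add (hliftg t) hst
    let q : {v // IsPoint (graphQuad Γ) v} :=
      ⟨(lift s).1 + (lift t).1, VertexGen.isPoint hnb hadd⟩
    refine ⟨{lift s, lift t, q}, mem_lines_cotri.2 ⟨_, _, _, hst, rfl, rfl⟩, ?_⟩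
    have hq : pointClass (lift r) = pointClass q := (hclass (hliftg r) hadd).2 (by
      rw [hliftπ, hr, ← hliftπ, ← hliftπ, ← map_add])
    rw [← Set.image_comp, Set.image_insert_eq, Set.image_pair, Set.image_insert_eq,
      Set.image_pair, ← hq]
    rfl
  · rintro ⟨l, hl, hml⟩
    obtain ⟨p, q, r, hpq, hr, rfl⟩ := mem_lines_cotri.1 hl
    rw [← Set.image_comp, Set.image_insert_eq, Set.image_pair] at hml
    obtain ⟨s, -, hs⟩ : pointClass p ∈ (Subtype.val ∘ ψ) '' m := by rw [hml]; exact .inl rfl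
    obtain ⟨t, -, ht⟩ : pointClass q ∈ (Subtype.val ∘ ψ) '' m := by
      rw [hml]; exact .inr (.inl rfl)
    obtain ⟨z, -, hz⟩ : pointClass r ∈ (Subtype.val ∘ ψ) '' m := by
      rw [hml]; exact .inr (.inr rfl)
    have hs' := (pointClass_eq_iff hnb).1 hs
    have ht' := (pointClass_eq_iff hnb).1 ht
    have hz' := (pointClass_eq_iff hnb).1 hz
    have hst : polar (graphQuad Γ) (lift s).1 (lift t).1 = 1 := by
      rw [hs', polar_comm, ht', polar_comm, hpq]
    have hadd := (hliftg s).add (hliftg t) hst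
    refine ⟨s, t, z, ?_, ?_, ?_⟩
    · rw [← hliftπ, ← hliftπ, hpol, hst]
    · rw [← hliftπ, ← hliftπ, ← hliftπ, ← map_add]
      refine (hclass (q := ⟨_, VertexGen.isPoint hnb hadd⟩) (hliftg z) hadd).1
        ((pointClass_eq_iff hnb).2 fun x => ?_)
      rw [hz', hr, polar_add_left, polar_add_left, hs', ht']
    · apply Set.image_injective.2 (Subtype.val_injective.comp hψinj)
      rw [hml, Set.image_insert_eq, Set.image_pair, hs, ht, hz]

end Pairs

/-! ## Pairs of a set with four elements -/

section Four

/-- The partition of four elements into two pairs, one of which is `{i, j}`, as an element of a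
set with three elements, represented by the pair of the two other elements. -/
def fourPair (i j : Fin 4) : Fin 3 × Fin 3 :=
  if (i = 0 ∧ j = 1) ∨ (i = 1 ∧ j = 0) ∨ (i = 2 ∧ j = 3) ∨ (i = 3 ∧ j = 2) then (1, 2)
  else if (i = 0 ∧ j = 2) ∨ (i = 2 ∧ j = 0) ∨ (i = 1 ∧ j = 3) ∨ (i = 3 ∧ j = 1) then (0, 2)
  else (0, 1)

theorem fourPair_ne : ∀ i j : Fin 4, (fourPair i j).1 ≠ (fourPair i j).2 := by decide

/-- Different pairs of four elements meet unless they are complementary, that is, unless they define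
the same partition; different pairs of three elements always meet. -/
theorem fourPair_adj : ∀ i j k l : Fin 4, i ≠ j → k ≠ l →
    ((s(i, j) ≠ s(k, l) ∧ ∃ o, o ∈ s(i, j) ∧ o ∈ s(k, l)) ↔
      s((fourPair i j).1, (fourPair i j).2) ≠ s((fourPair k l).1, (fourPair k l).2) ∧
        ∃ o, o ∈ s((fourPair i j).1, (fourPair i j).2) ∧
          o ∈ s((fourPair k l).1, (fourPair k l).2)) := by decide +kernel

theorem three_cover : ∀ i j k l : Fin 3, i ≠ j → k ≠ l → s(i, j) ≠ s(k, l) →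
    ∀ o, o ∈ s(i, j) ∨ o ∈ s(k, l) := by decide

theorem pairs_map_iff {Ω Ω' : Type*} {f : Ω → Ω'} (hf : Function.Injective f) (a b c d : Ω) :
    (s(f a, f b) ≠ s(f c, f d) ∧ ∃ o, o ∈ s(f a, f b) ∧ o ∈ s(f c, f d)) ↔
      s(a, b) ≠ s(c, d) ∧ ∃ o, o ∈ s(a, b) ∧ o ∈ s(c, d) := by
  rw [← Sym2.map_mk, ← Sym2.map_mk, (Sym2.map.injective hf).ne_iff]
  refine and_congr_right fun _ => ⟨?_, ?_⟩
  · rintro ⟨_, h1, h2⟩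
    obtain ⟨o, ho, rfl⟩ := Sym2.mem_map.1 h1
    obtain ⟨o', ho', h⟩ := Sym2.mem_map.1 h2
    exact ⟨o, ho, hf h ▸ ho'⟩
  · rintro ⟨o, h1, h2⟩
    exact ⟨f o, Sym2.mem_map.2 ⟨o, h1, rfl⟩, Sym2.mem_map.2 ⟨o, h2, rfl⟩⟩

variable {V : Type u} {Γ : SimpleGraph V}

/-- If `|Ω| = 4`, each pair is replaced by its partition into two pairs. Two adjacent vertices have
different images, and these already cover the three elements. -/
theorem exists_pairs_card_ne_four (hnb : ∀ x, ∃ y, Γ.Adj x y) [Nonempty V] {Ω : Type u}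
    {a d : V → Ω} (had : ∀ x, a x ≠ d x) (hadj : ∀ x y, Γ.Adj x y ↔
      s(a x, d x) ≠ s(a y, d y) ∧ ∃ o, o ∈ s(a x, d x) ∧ o ∈ s(a y, d y))
    (hcov : ∀ o, ∃ x, o ∈ s(a x, d x)) : ∃ (Ω : Type u) (a d : V → Ω), (∀ x, a x ≠ d x) ∧
      (∀ x y, Γ.Adj x y ↔
        s(a x, d x) ≠ s(a y, d y) ∧ ∃ o, o ∈ s(a x, d x) ∧ o ∈ s(a y, d y)) ∧
      (∀ o, ∃ x, o ∈ s(a x, d x)) ∧ ∀ t : Finset Ω, t.card = 4 → ∃ o, o ∉ t := by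
  by_cases h4 : ∀ t : Finset Ω, t.card = 4 → ∃ o, o ∉ t
  · exact ⟨Ω, a, d, had, hadj, hcov, h4⟩
  push Not at h4
  obtain ⟨t, ht, htop⟩ := h4
  have ε : Ω ≃ Fin 4 :=
    (Equiv.subtypeUnivEquiv htop).symm.trans (t.equivFinOfCardEq ht)
  have hne (x) : ε (a x) ≠ ε (d x) := ε.injective.ne (had x)
  have hadj' (x y) : Γ.Adj x y ↔ _ := ((hadj x y).trans
    (pairs_map_iff ε.injective _ _ _ _).symm).trans (fourPair_adj _ _ _ _ (hne x) (hne y))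
  refine ⟨ULift (Fin 3), fun x => ⟨(fourPair (ε (a x)) (ε (d x))).1⟩,
    fun x => ⟨(fourPair (ε (a x)) (ε (d x))).2⟩, ?_, ?_, ?_, ?_⟩
  · intro x h
    exact fourPair_ne _ _ (ULift.up_injective h)
  · intro x y
    rw [pairs_map_iff ULift.up_injective]
    exact hadj' x y
  · rintro ⟨o⟩
    obtain ⟨x⟩ := ‹Nonempty V›
    obtain ⟨y, hxy⟩ := hnb x
    rcases three_cover _ _ _ _ (fourPair_ne _ _) (fourPair_ne _ _) ((hadj' x y).1 hxy).1 o
      with h | h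
    · exact ⟨x, by simpa [Sym2.mem_iff, ULift.ext_iff] using h⟩
    · exact ⟨y, by simpa [Sym2.mem_iff, ULift.ext_iff] using h⟩
  · intro t ht
    have h1 := Finset.card_le_univ t
    simp [ht] at h1

theorem exists_pairs_of_isLineGraph [LinearOrder V] (hnb : ∀ x, ∃ y, Γ.Adj x y) [Nonempty V]
    (h : IsLineGraph (reducedGraph Γ)) : ∃ (Ω : Type u) (a d : V → Ω), (∀ x, a x ≠ d x) ∧
      (∀ x y, Γ.Adj x y ↔
        s(a x, d x) ≠ s(a y, d y) ∧ ∃ o, o ∈ s(a x, d x) ∧ o ∈ s(a y, d y)) ∧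
      (∀ o, ∃ x, o ∈ s(a x, d x)) ∧ ∀ t : Finset Ω, t.card = 4 → ∃ o, o ∉ t := by
  obtain ⟨Ω, Δ, ⟨φ⟩⟩ := h
  have hq (x : V) : ∃ p : Ω × Ω, p.1 ≠ p.2 ∧ s(p.1, p.2) = (φ (Quotient.mk _ x)).1 := by
    obtain ⟨⟨a, b⟩, hp⟩ := Sym2.mk_surjective (φ (Quotient.mk _ x)).1
    refine ⟨(a, b), ?_, hp⟩
    have h1 := (φ (Quotient.mk _ x)).2
    rw [← hp] at h1
    exact (Δ.mem_edgeSet.1 h1).ne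
  choose q hq1 hq2 using hq
  have hadj (x y : V) : Γ.Adj x y ↔ s((q x).1, (q x).2) ≠ s((q y).1, (q y).2) ∧
      ∃ o, o ∈ s((q x).1, (q x).2) ∧ o ∈ s((q y).1, (q y).2) := by
    rw [← reducedGraph_adj, ← φ.map_adj_iff, hq2, hq2]
    simp only [SimpleGraph.lineGraph, ne_eq, Subtype.ext_iff]
    rfl
  -- Elements of `Ω` in no pair are discarded, since they could not be reached by the closure.
  let T := {o : Ω // ∃ x, o ∈ s((q x).1, (q x).2)}
  have ha (x : V) : ∃ x', (q x).1 ∈ s((q x').1, (q x').2) := ⟨x, Sym2.mem_mk_left _ _⟩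
  have hd (x : V) : ∃ x', (q x).2 ∈ s((q x').1, (q x').2) := ⟨x, Sym2.mem_mk_right _ _⟩
  refine exists_pairs_card_ne_four hnb (Ω := T) (a := fun x => ⟨(q x).1, ha x⟩)
    (d := fun x => ⟨(q x).2, hd x⟩) ?_ ?_ ?_
  · intro x h
    exact hq1 x (congrArg Subtype.val h)
  · intro x y
    rw [hadj, ← pairs_map_iff (f := (Subtype.val : T → Ω)) Subtype.val_injective]
  · rintro ⟨o, x, hx⟩
    refine ⟨x, Sym2.mem_iff.2 ?_⟩
    exact (Sym2.mem_iff.1 hx).imp (fun h => Subtype.ext h) (fun h => Subtype.ext h)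

end Four

/-! ## The graph with one vertex -/

section Subsingleton

variable {V : Type u} [LinearOrder V] (Γ : SimpleGraph V) [Subsingleton V]

theorem not_isPoint_of_subsingleton (v : V →₀ ZMod 2) : ¬ IsPoint (graphQuad Γ) v := by
  rintro ⟨-, w, hw⟩
  refine hw ?_
  rw [polar_eq_of_single (v := v) (w := 0), polar_zero_left]
  intro x
  rw [polar_zero_left, polar_comm, polar_eq_of_single (v := Finsupp.single x 1) (w := 0),
    polar_zero_left]
  intro y
  rw [Subsingleton.elim y x, polar_self_zero, polar_zero_left]

/-- With at most one vertex the polar form vanishes, so there are no points, and the empty set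
serves as `Ω`. -/
theorem nonempty_iso_of_subsingleton :
    Nonempty ((reducedSpace Γ).Iso (triangular (PEmpty : Type u))) := by
  have : IsEmpty ((cotri (graphQuad Γ)).reduction.gen (vertexClasses Γ)) :=
    ⟨fun c => Quotient.inductionOn c.1 fun p => not_isPoint_of_subsingleton Γ p.1 p.2⟩
  have : IsEmpty {s : Finset (PEmpty : Type u) // s.card = 2} :=
    ⟨fun ⟨s, hs⟩ => by rw [Subsingleton.elim s ∅] at hs; simp at hs⟩
  refine ⟨⟨Equiv.equivOfIsEmpty _ _, fun l => ⟨?_, ?_⟩⟩⟩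
  · rintro ⟨l', hl', -⟩
    obtain ⟨p, -⟩ := mem_lines_cotri.1 hl'
    exact (not_isPoint_of_subsingleton Γ p.1 p.2).elim
  · rintro ⟨t, ht, -⟩
    rw [Subsingleton.elim t ∅] at ht
    simp at ht

theorem omegaLie_eq_bot (F : Type w) [Field F] (Ω : Type u) [LinearOrder Ω] [IsEmpty Ω] :
    omegaLie F Ω = ⊥ := by
  rw [eq_bot_iff]
  change Submodule.span F (lieE F (omegaForm Ω) '' weightTwo Ω) ≤ ⊥
  rw [Submodule.span_le]
  rintro _ ⟨v, ⟨a, -⟩, rfl⟩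
  exact isEmptyElim a

theorem exists_quotient_equiv_bot {R L L' : Type*} [CommRing R] [LieRing L] [LieAlgebra R L]
    [LieRing L'] [LieAlgebra R L'] (K : LieSubalgebra R L) :
    ∃ I : LieIdeal R K, Nonempty ((K ⧸ I) ≃ₗ⁅R⁆ (⊥ : LieSubalgebra R L')) := by
  refine exists_quotient_equiv_map (0 : L →ₗ⁅R⁆ L') K ⊥ ?_
  rw [eq_bot_iff]
  rintro _ ⟨x, -, rfl⟩
  exact rfl

end Subsingleton

/-! ## The isomorphism of `𝔤(Ω)` with the orthogonal Lie algebra -/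

section Orthogonal

variable (F : Type w) [Field F] {Ω : Type u} [LinearOrder Ω] {ι : Type*}

theorem e_zero {V : Type*} [AddCommGroup V] [Module (ZMod 2) V]
    (g : LinearMap.BilinForm (ZMod 2) V) : e F g 0 = 1 := rfl

theorem omegaForm_add_swap {a b : Ω} (h : a ≠ b) :
    omegaForm Ω (Finsupp.single a 1) (Finsupp.single b 1) +
      omegaForm Ω (Finsupp.single b 1) (Finsupp.single a 1) = 1 := by
  rw [← polar_quad, polar_omega, if_neg h]

/-- The sign of a pair. -/
def pairSign (a b : Ω) : F := sgn F (omegaForm Ω (Finsupp.single a 1) (Finsupp.single b 1))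

theorem pairSign_mul_self (a b : Ω) : pairSign F a b * pairSign F a b = 1 := sgn_mul_self F _

theorem pairSign_swap {a b : Ω} (h : a ≠ b) : pairSign F b a = -pairSign F a b := by
  have h1 := omegaForm_add_swap h
  unfold pairSign
  rcases zmod2_cases (omegaForm Ω (Finsupp.single a 1) (Finsupp.single b 1)) with ha | ha <;>
    rcases zmod2_cases (omegaForm Ω (Finsupp.single b 1) (Finsupp.single a 1)) with hb | hb <;>
    rw [ha, hb] at h1 ⊢
  · exact absurd h1 (by decide)
  · rw [sgn_zero, sgn_one]
  · rw [sgn_zero, sgn_one, neg_neg]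
  · exact absurd h1 (by decide)

/-- The generators of the Clifford algebra. -/
def cliffGen (o : ι → Ω) (i : ι) : Cliff F (omegaForm Ω) :=
  e F (omegaForm Ω) (Finsupp.single (o i) 1)

theorem cliffGen_mul (o : ι → Ω) (i j : ι) : cliffGen F o i * cliffGen F o j =
    pairSign F (o i) (o j) • e F (omegaForm Ω) (Finsupp.single (o i) 1 + Finsupp.single (o j) 1) :=
  e_mul_e _ _ _

theorem cliffGen_mul_self (o : ι → Ω) (i : ι) : cliffGen F o i * cliffGen F o i = 1 := by
  rw [cliffGen_mul, ZModModule.add_self, pairSign]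
  simp [graphForm_single, sgn_zero, e_zero]

/-- The commutator is computed by moving `x c` and `x d` to the front of `x a * x b`. The subtracted
scalars are central on the left, and on the right they cancel because `δ` is symmetric; the factor 2
in the relations absorbs the one half. -/
theorem halfBracket_of_anticomm {A : Type*} [Ring A] [Algebra F A] (hF : (2 : F) ≠ 0) {x : ι → A}
    {δ : ι → ι → F} (hδ : ∀ i j, δ i j = δ j i)
    (hx : ∀ i j, x i * x j + x j * x i = (2 * δ i j) • 1) (a b c d : ι) :
    halfBracket F (x a * x b - δ a b • 1) (x c * x d - δ c d • 1) =
      δ b c • (x a * x d - δ a d • 1) - δ a c • (x b * x d - δ b d • 1) +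
        δ b d • (x c * x a - δ c a • 1) - δ a d • (x c * x b - δ c b • 1) := by
  have h1 : (x a * x b - δ a b • 1) * (x c * x d - δ c d • 1) -
      (x c * x d - δ c d • 1) * (x a * x b - δ a b • 1) =
      x a * (x b * x c + x c * x b) * x d - (x a * x c + x c * x a) * (x b * x d) +
        x c * x a * (x b * x d + x d * x b) - x c * (x a * x d + x d * x a) * x b := by
    simp only [mul_sub, sub_mul, mul_smul_comm, smul_mul_assoc, mul_one, one_mul, mul_add, add_mul,
      mul_assoc]
    module
  rw [halfBracket, h1]
  simp only [hx, mul_smul_comm, smul_mul_assoc, mul_one, one_mul, hδ c a, hδ c b]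
  match_scalars
  all_goals field_simp
  ring

variable [DecidableEq ι]

theorem cliffGen_anticomm {o : ι → Ω} (ho : Function.Injective o) (i j : ι) :
    cliffGen F o i * cliffGen F o j + cliffGen F o j * cliffGen F o i =
      (2 * if i = j then 1 else 0 : F) • 1 := by
  by_cases hij : i = j
  · subst hij
    rw [cliffGen_mul_self, if_pos rfl, mul_one]
    exact (two_smul F _).symm
  · rw [cliffGen_mul, cliffGen_mul, pairSign_swap F (ho.ne hij), add_comm (Finsupp.single (o j) 1),
      ← add_smul, add_neg_cancel, if_neg hij, mul_zero, zero_smul, zero_smul]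

/-- The bivectors of the Clifford algebra. -/
def bivector (o : ι → Ω) (i j : ι) : LieCliff F (omegaForm Ω) :=
  toHalfLie F (cliffGen F o i * cliffGen F o j - (if i = j then 1 else 0 : F) • 1)

theorem bivector_self (o : ι → Ω) (i : ι) : bivector F o i i = 0 := by
  rw [bivector, cliffGen_mul_self, if_pos rfl, one_smul, sub_self]
  rfl

theorem bivector_of_ne (o : ι → Ω) {i j : ι} (h : i ≠ j) : bivector F o i j =
    pairSign F (o i) (o j) •
      lieE F (omegaForm Ω) (Finsupp.single (o i) 1 + Finsupp.single (o j) 1) := by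
  rw [bivector, cliffGen_mul, if_neg h, zero_smul, sub_zero]
  rfl

theorem bivector_swap {o : ι → Ω} (ho : Function.Injective o) (i j : ι) :
    bivector F o j i = -bivector F o i j := by
  by_cases hij : i = j
  · subst hij; rw [bivector_self, neg_zero]
  · rw [bivector_of_ne F o hij, bivector_of_ne F o (Ne.symm hij), pairSign_swap F (ho.ne hij),
      add_comm (Finsupp.single (o j) 1), neg_smul]

theorem lie_bivector (hF : (2 : F) ≠ 0) {o : ι → Ω} (ho : Function.Injective o) (a b c d : ι) :
    ⁅bivector F o a b, bivector F o c d⁆ =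
      (if b = c then 1 else 0 : F) • bivector F o a d -
        (if a = c then 1 else 0 : F) • bivector F o b d +
        (if b = d then 1 else 0 : F) • bivector F o c a -
        (if a = d then 1 else 0 : F) • bivector F o c b :=
  halfBracket_of_anticomm F hF (δ := fun i j => if i = j then 1 else 0)
    (fun i j => by simp only [eq_comm]) (cliffGen_anticomm F ho) a b c d

/-- The elementary skew-symmetric matrices. -/
def skewSingle (i j : ι) : Matrix ι ι F := Matrix.single i j 1 - Matrix.single j i 1

open Classical in
/-- The matrix of coefficients of an element of the Clifford algebra at the bivectors. -/
def bivectorToMatrix (o : ι → Ω) : LieCliff F (omegaForm Ω) →ₗ[F] Matrix ι ι F :=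
  (Finsupp.linearCombination F (fun v => Matrix.of fun i j =>
    if i ≠ j ∧ v = Finsupp.single (o i) 1 + Finsupp.single (o j) 1 then
      pairSign F (o i) (o j) else 0) : ((Ω →₀ ZMod 2) →₀ F) →ₗ[F] Matrix ι ι F)

theorem single_add_single_eq_iff {a b c d : Ω} (hab : a ≠ b) (hcd : c ≠ d) :
    (Finsupp.single a 1 + Finsupp.single b 1 : Ω →₀ ZMod 2) =
      Finsupp.single c 1 + Finsupp.single d 1 ↔ a = c ∧ b = d ∨ a = d ∧ b = c := by
  constructor
  · intro h
    rw [← setVec_pair hab, ← setVec_pair hcd] at h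
    have h1 := setVec_injective h
    have ha : a ∈ ({c, d} : Finset Ω) := by rw [← h1]; simp
    have hb : b ∈ ({c, d} : Finset Ω) := by rw [← h1]; simp
    simp only [Finset.mem_insert, Finset.mem_singleton] at ha hb
    rcases ha with rfl | rfl <;> rcases hb with rfl | rfl <;> tauto
  · rintro (⟨rfl, rfl⟩ | ⟨rfl, rfl⟩)
    · rfl
    · exact add_comm _ _

theorem bivectorToMatrix_bivector {o : ι → Ω} (ho : Function.Injective o) (i j : ι) :
    bivectorToMatrix F o (bivector F o i j) = skewSingle F i j := by
  by_cases hij : i = j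
  · subst hij
    rw [bivector_self, map_zero, skewSingle, sub_self]
  rw [bivector_of_ne F o hij, map_smul]
  have h1 : bivectorToMatrix F o (lieE F (omegaForm Ω) (Finsupp.single (o i) 1 +
      Finsupp.single (o j) 1)) = _ :=
    (Finsupp.linearCombination_single F (1 : F) _).trans (one_smul F _)
  rw [h1]
  ext k l
  simp only [Matrix.smul_apply, Matrix.of_apply, smul_eq_mul, skewSingle, Matrix.sub_apply,
    Matrix.single_apply]
  by_cases hkl : k = l
  · subst hkl
    have h2 : ¬ (i = k ∧ j = k) := fun h => hij (h.1.trans h.2.symm)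
    have h3 : ¬ (j = k ∧ i = k) := fun h => hij (h.2.trans h.1.symm)
    simp [h2, h3]
  · simp only [ne_eq, hkl, not_false_eq_true, true_and,
      single_add_single_eq_iff (ho.ne hij) (ho.ne hkl), ho.eq_iff]
    by_cases h2 : i = k ∧ j = l
    · obtain ⟨rfl, rfl⟩ := h2
      simp [hij, pairSign_mul_self]
    · by_cases h3 : i = l ∧ j = k
      · obtain ⟨rfl, rfl⟩ := h3
        simp [hij, Ne.symm hij, pairSign_swap F (ho.ne hij), pairSign_mul_self]
      · have h4 : ¬ (j = k ∧ i = l) := fun h => h3 ⟨h.2, h.1⟩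
        simp [h2, h3, h4]

variable [Fintype ι]

theorem single_mul_single (i j k l : ι) :
    (Matrix.single i j 1 * Matrix.single k l 1 : Matrix ι ι F) = (if j = k then 1 else 0 : F) • Matrix.single i l 1 := by
  split_ifs with h
  · subst h; simp
  · simp [h]

theorem lie_skewSingle (a b c d : ι) : ⁅skewSingle F a b, skewSingle F c d⁆ =
    (if b = c then 1 else 0 : F) • skewSingle F a d -
      (if a = c then 1 else 0 : F) • skewSingle F b d +
      (if b = d then 1 else 0 : F) • skewSingle F c a -
      (if a = d then 1 else 0 : F) • skewSingle F c b := by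
  simp only [skewSingle, Ring.lie_def, sub_mul, mul_sub, single_mul_single, smul_sub,
    @eq_comm _ c, @eq_comm _ d]
  abel

theorem skewSingle_mem_so (i j : ι) : skewSingle F i j ∈ LieAlgebra.Orthogonal.so ι F := by
  rw [LieAlgebra.Orthogonal.mem_so]
  simp [skewSingle]

/-- The double sum is `A - Aᵀ = 2A`, as each unordered pair of indices is counted twice. -/
theorem eq_sum_skewSingle (hF : (2 : F) ≠ 0) {A : Matrix ι ι F}
    (hA : A ∈ LieAlgebra.Orthogonal.so ι F) :
    A = (2 : F)⁻¹ • ∑ i, ∑ j, A i j • skewSingle F i j := by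
  rw [LieAlgebra.Orthogonal.mem_so] at hA
  have h1 : ∑ i, ∑ j, A i j • skewSingle F i j = A - A.transpose := by
    simp only [skewSingle, smul_sub, Finset.sum_sub_distrib]
    congr 1
    · conv_rhs => rw [Matrix.matrix_eq_sum_single A]
      simp [Matrix.smul_single]
    · conv_rhs => rw [Matrix.matrix_eq_sum_single A.transpose]
      rw [Finset.sum_comm]
      simp [Matrix.smul_single]
  rw [h1, hA, sub_neg_eq_add, ← two_smul F A, smul_smul, inv_mul_cancel₀ hF, one_smul]

/-- The linear map from matrices to bivectors. -/
def matrixToBivector (o : ι → Ω) : Matrix ι ι F →ₗ[F] LieCliff F (omegaForm Ω) where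
  toFun A := (2 : F)⁻¹ • ∑ i, ∑ j, A i j • bivector F o i j
  map_add' A B := by
    simp only [Matrix.add_apply, add_smul, Finset.sum_add_distrib, smul_add]
  map_smul' r A := by
    simp only [Matrix.smul_apply, smul_eq_mul, mul_smul, ← Finset.smul_sum, RingHom.id_apply]
    rw [smul_comm]

theorem matrixToBivector_skewSingle (hF : (2 : F) ≠ 0) {o : ι → Ω} (ho : Function.Injective o)
    (i j : ι) : matrixToBivector F o (skewSingle F i j) = bivector F o i j := by
  have h1 (i j : ι) : matrixToBivector F o (Matrix.single i j 1) =
      (2 : F)⁻¹ • bivector F o i j := by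
    change (2 : F)⁻¹ • ∑ k, ∑ l, Matrix.single i j 1 k l • bivector F o k l = _
    congr 1
    rw [Finset.sum_eq_single i, Finset.sum_eq_single j]
    · simp
    · intro l _ hl
      simp [hl.symm]
    · simp
    · intro k _ hk
      simp [hk.symm]
    · simp
  rw [skewSingle, map_sub, h1, h1, bivector_swap F ho i j, smul_neg, sub_neg_eq_add, ← add_smul,
    ← two_mul, mul_inv_cancel₀ hF, one_smul]

/-- By bilinearity it suffices to treat elementary skew-symmetric matrices, whose brackets obey the
same formula as those of the bivectors. -/
theorem matrixToBivector_lie (hF : (2 : F) ≠ 0) {o : ι → Ω} (ho : Function.Injective o)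
    {A B : Matrix ι ι F} (hA : A ∈ LieAlgebra.Orthogonal.so ι F)
    (hB : B ∈ LieAlgebra.Orthogonal.so ι F) :
    matrixToBivector F o ⁅A, B⁆ = ⁅matrixToBivector F o A, matrixToBivector F o B⁆ := by
  have key (i j k l : ι) : matrixToBivector F o ⁅skewSingle F i j, skewSingle F k l⁆ =
      ⁅bivector F o i j, bivector F o k l⁆ := by
    rw [lie_skewSingle, lie_bivector F hF ho]
    simp only [map_add, map_sub, map_smul, matrixToBivector_skewSingle F hF ho]
  let _ : LieRing (Matrix ι ι F) := LieRing.ofAssociativeRing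
  let _ : LieAlgebra F (Matrix ι ι F) := LieAlgebra.ofAssociativeAlgebra
  rw [eq_sum_skewSingle F hF hA, eq_sum_skewSingle F hF hB]
  simp only [smul_lie, lie_smul, sum_lie, lie_sum, map_smul, map_sum, key,
    matrixToBivector_skewSingle F hF ho]

theorem bivectorToMatrix_matrixToBivector (hF : (2 : F) ≠ 0) {o : ι → Ω}
    (ho : Function.Injective o) {A : Matrix ι ι F} (hA : A ∈ LieAlgebra.Orthogonal.so ι F) :
    bivectorToMatrix F o (matrixToBivector F o A) = A := by
  conv_rhs => rw [eq_sum_skewSingle F hF hA]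
  simp only [matrixToBivector, LinearMap.coe_mk, AddHom.coe_mk, map_smul, map_sum,
    bivectorToMatrix_bivector F ho]

/-- Reading off coefficients inverts the map from skew-symmetric matrices to bivectors. The
bivectors of different indices are the `e_v` of weight two up to sign, so the image is `𝔤(Ω)`. -/
theorem nonempty_omegaLie_equiv_so (hF : (2 : F) ≠ 0) (o : ι ≃ Ω) :
    Nonempty (omegaLie F Ω ≃ₗ⁅F⁆ LieAlgebra.Orthogonal.so ι F) := by
  let γ : LieAlgebra.Orthogonal.so ι F →ₗ⁅F⁆ LieCliff F (omegaForm Ω) :=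
    { toFun := fun A => matrixToBivector F o A.1
      map_add' := fun A B => map_add (matrixToBivector F o) A.1 B.1
      map_smul' := fun r A => map_smul (matrixToBivector F o) r A.1
      map_lie' := fun {A B} => matrixToBivector_lie F hF o.injective A.2 B.2 }
  have hγ (A : LieAlgebra.Orthogonal.so ι F) : γ A = matrixToBivector F o A.1 := rfl
  have hinj : Function.Injective γ := by
    intro A B h
    apply Subtype.ext
    rw [← bivectorToMatrix_matrixToBivector F hF o.injective A.2,
      ← bivectorToMatrix_matrixToBivector F hF o.injective B.2, ← hγ, ← hγ, h]
  have hmem (i j : ι) : bivector F o i j ∈ omegaLie F Ω := by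
    by_cases hij : i = j
    · subst hij
      rw [bivector_self]
      exact zero_mem _
    · rw [bivector_of_ne F o hij]
      exact Submodule.smul_mem _ _ (Submodule.subset_span
        ⟨_, ⟨o i, o j, o.injective.ne hij, rfl⟩, rfl⟩)
  have hrange : γ.range = omegaLie F Ω := by
    apply le_antisymm
    · rintro _ ⟨A, rfl⟩
      change matrixToBivector F o A.1 ∈ (omegaLie F Ω).toSubmodule
      exact Submodule.smul_mem _ _ (Submodule.sum_mem _ fun i _ => Submodule.sum_mem _ fun j _ =>
        Submodule.smul_mem _ _ (hmem i j))
    · change Submodule.span F (lieE F (omegaForm Ω) '' weightTwo Ω) ≤ γ.range.toSubmodule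
      rw [Submodule.span_le]
      rintro _ ⟨_, ⟨a, b, hab, rfl⟩, rfl⟩
      obtain ⟨i, rfl⟩ := o.surjective a
      obtain ⟨j, rfl⟩ := o.surjective b
      have hij : i ≠ j := fun h => hab (congrArg o h)
      have h1 : bivector F o i j ∈ γ.range :=
        ⟨⟨skewSingle F i j, skewSingle_mem_so F i j⟩,
          matrixToBivector_skewSingle F hF o.injective i j⟩
      have h2 := γ.range.smul_mem (pairSign F (o i) (o j)) h1
      rw [bivector_of_ne F o hij, smul_smul, pairSign_mul_self, one_smul] at h2
      exact h2
  rw [← hrange]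
  exact ⟨(LieEquiv.ofInjective γ hinj).symm⟩

end Orthogonal

end QuasiClifford

end

/-! ### The two cases of the theorem. -/

theorem mainTheorem4 (F : Type w) [Field F] (hF : (2 : F) ≠ 0)
    (V : Type u) [LinearOrder V] (Γ : SimpleGraph V) (hΓ : Γ.Connected)
    [LinearOrder (QuasiClifford.ReducedVertex Γ)] :
    (¬ QuasiClifford.IsLineGraph (QuasiClifford.reducedGraph Γ) →
      (∃ I : LieIdeal F (QuasiClifford.vertexGenerated Γ Set.univ F),
        Nonempty ((QuasiClifford.vertexGenerated Γ Set.univ F ⧸ I) ≃ₗ⁅F⁆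
          QuasiClifford.pointLie F
            (QuasiClifford.graphForm (QuasiClifford.reducedGraph Γ) Set.univ))) ∧
      ((∀ v, QuasiClifford.graphQuad (QuasiClifford.reducedGraph Γ) v = 1 →
          ∃ w, QuadraticMap.polar
            (QuasiClifford.graphQuad (QuasiClifford.reducedGraph Γ)) v w ≠ 0) →
        ∃ I : LieIdeal F (QuasiClifford.vertexGenerated Γ Set.univ F),
          Nonempty ((QuasiClifford.vertexGenerated Γ Set.univ F ⧸ I) ≃ₗ⁅F⁆
            QuasiClifford.nonisotropicLie F
              (QuasiClifford.graphForm (QuasiClifford.reducedGraph Γ) Set.univ)))) ∧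
    (QuasiClifford.IsLineGraph (QuasiClifford.reducedGraph Γ) →
      ∃ Ω : Type u,
        Nonempty (QuasiClifford.PointLine.Iso (QuasiClifford.reducedSpace Γ)
          (QuasiClifford.triangular Ω)) ∧
        ∀ [LinearOrder Ω],
          (∃ I : LieIdeal F (QuasiClifford.vertexGenerated Γ Set.univ F),
            Nonempty ((QuasiClifford.vertexGenerated Γ Set.univ F ⧸ I) ≃ₗ⁅F⁆
              QuasiClifford.omegaLie F Ω)) ∧
          ∀ n : ℕ, Finite Ω → Nat.card Ω = n →
            Nonempty (QuasiClifford.omegaLie F Ω ≃ₗ⁅F⁆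
              LieAlgebra.Orthogonal.so (Fin n) F)) := by
  have hso (Ω : Type u) [LinearOrder Ω] (n : ℕ) (hfin : Finite Ω) (hn : Nat.card Ω = n) :
      Nonempty (QuasiClifford.omegaLie F Ω ≃ₗ⁅F⁆ LieAlgebra.Orthogonal.so (Fin n) F) :=
    QuasiClifford.nonempty_omegaLie_equiv_so F hF (Finite.equivFinOfCardEq hn).symm
  refine ⟨fun hline => ?_, fun hline => ?_⟩
  · have h1 := QuasiClifford.exists_quotient_equiv_pointLie Γ F hF hΓ.preconnected hline
    refine ⟨h1, fun h => ?_⟩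
    rw [QuasiClifford.nonisotropicLie_eq_pointLie F _ h]
    exact h1
  -- A single vertex is not a point of the cotriangular space, so this case is separate, with `Ω`
  -- empty and `𝔤(Ω) = 0`.
  · cases subsingleton_or_nontrivial V with
    | inl h =>
      refine ⟨PEmpty, QuasiClifford.nonempty_iso_of_subsingleton Γ, ?_⟩
      intro _
      refine ⟨?_, hso _⟩
      rw [QuasiClifford.omegaLie_eq_bot]
      exact QuasiClifford.exists_quotient_equiv_bot _
    | inr h =>
      have hnb (x : V) : ∃ y, Γ.Adj x y := by
        obtain ⟨y, hy⟩ := exists_ne x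
        exact QuasiClifford.exists_adj_of_preconnected hΓ.preconnected hy.symm
      obtain ⟨Ω, a, d, had, hadj, hcov, h4⟩ :=
        QuasiClifford.exists_pairs_of_isLineGraph hnb hline
      exact ⟨Ω, QuasiClifford.nonempty_iso_triangular had hadj hcov hΓ.preconnected hnb h4,
        ⟨QuasiClifford.exists_quotient_equiv_omegaLie F hF had hadj hcov hΓ.preconnected, hso Ω⟩⟩
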